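/- Conventions. All spaces are Hausdorff and all Banach spaces are real. A topological space $X$ is *scattered* if every non-empty subspace has a relatively isolated point; it has a *$G_\delta$-diagonal* if $\{(x,x):x\in X\}$ is a $G_\delta$ subset of $X^2$. $X$ is *Gruenhage* if there are families $(\mathscr U_n)_{n\ge 1}$ of open subsets of $X$ and sets $(R_n)_{n\geq 1}$ such that (1) for all distinct $x,y\in X$ there are $n$ and $U\in\mathscr U_n$ such that $\{x,y\}\cap U$ is a singleton, and (2) $U\cap V=R_n$ whenever $U,V\in\mathscr U_n$ are distinct. $X$ has $(*)$ if there are families $(\mathscr U_n)_{n\ge1}$ of open subsets of $X$ such that for all distinct $x,y\in X$ there is $n$ such that $\{x,y\}\cap\bigcup\mathscr U_n\neq\varnothing$ and $\{x,y\}\cap U$ has at most one point for every $U\in\mathscr U_n$. A norm $\|\cdot\|$ is *strictly convex* if $\|f\|=\|g\|=\|\frac12(f+g)\|$ implies $f=g$. A *dual norm* on a dual Banach space $E^*$ is the norm $f\mapsto\sup\{f(x):\ p(x)\le 1\}$ dual to some norm $p$ on $E$ equivalent to the given one. Theorem. Assume the continuum hypothesis $\aleph_1=2^{\aleph_0}$.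 Then there is a locally compact, scattered, first countable Hausdorff space $X$ with a $G_\delta$-diagonal that is not Gruenhage, such that moreover its one-point compactification $K=X\cup\{\infty\}$ is a compact, scattered Hausdorff space which is not Gruenhage but has $(*)$, and $C(K)^*$ admits an equivalent strictly convex dual norm. In particular, the existence of a strictly convex dual norm on $C(K)^*$ does not imply that the compact space $K$ is Gruenhage. -/

import Mathlib

/-- A space is scattered if every non-empty subset `S` has a relatively isolated point. -/
def IsScatteredSpace (X : Type*) [TopologicalSpace X] : Prop :=
  ∀ S : Set X, S.Nonempty → ∃ x ∈ S, ∃ U : Set X, IsOpen U ∧ S ∩ U = {x}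

/-- A space is Gruenhage if there are families `𝒰 n` of open sets and sets `R n` such that the
members of the `𝒰 n` separate points (for distinct `x, y`, some member of some `𝒰 n` contains
exactly one of them) and distinct members of `𝒰 n` intersect exactly in `R n`. -/
def IsGruenhage (X : Type*) [TopologicalSpace X] : Prop :=
  ∃ (𝒰 : ℕ → Set (Set X)) (R : ℕ → Set X),
    (∀ n, ∀ U ∈ 𝒰 n, IsOpen U) ∧
    (∀ x y : X, x ≠ y → ∃ n, ∃ U ∈ 𝒰 n, ∃ z, {x, y} ∩ U = {z}) ∧
    (∀ n, ∀ U ∈ 𝒰 n, ∀ V ∈ 𝒰 n, U ≠ V → U ∩ V = R n)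

/-- Property (*): there are families `𝒰 n` of open sets such that for distinct `x, y` there is
an `n` for which `{x, y}` meets the union of `𝒰 n`, while every member of `𝒰 n` contains
at most one of `x` and `y`. -/
def HasStar (X : Type*) [TopologicalSpace X] : Prop :=
  ∃ 𝒰 : ℕ → Set (Set X),
    (∀ n, ∀ U ∈ 𝒰 n, IsOpen U) ∧
    (∀ x y : X, x ≠ y → ∃ n,
      ({x, y} ∩ ⋃₀ 𝒰 n).Nonempty ∧ ∀ U ∈ 𝒰 n, ({x, y} ∩ U).Subsingleton)

/-- The seminorm `p` on the normed space `E` is a norm equivalent to the given one. -/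
def IsEquivalentNorm {E : Type*} [NormedAddCommGroup E] [NormedSpace ℝ E]
    (p : Seminorm ℝ E) : Prop :=
  ∃ c C : ℝ, 0 < c ∧ 0 < C ∧ ∀ x : E, c * ‖x‖ ≤ p x ∧ p x ≤ C * ‖x‖

/-- `q` is the norm on the dual of `E` dual to the norm `p` on `E`: for every functional `f`,
`q f` is the supremum of `f` over the closed unit ball of `p`. -/
def IsDualNormOf {E : Type*} [NormedAddCommGroup E] [NormedSpace ℝ E]
    (q : Seminorm ℝ (StrongDual ℝ E)) (p : Seminorm ℝ E) : Prop :=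
  ∀ f : StrongDual ℝ E, IsLUB {r : ℝ | ∃ x : E, p x ≤ 1 ∧ f x = r} (q f)

/-- Strict convexity of a norm: `‖x‖ = ‖y‖ = ‖(x + y) / 2‖` implies `x = y`. -/
def IsStrictlyConvexNorm {F : Type*} [AddCommGroup F] [Module ℝ F]
    (q : Seminorm ℝ F) : Prop :=
  ∀ x y : F, q x = q y → q y = q ((1 / 2 : ℝ) • (x + y)) → x = y

/-- The dual of `E` admits an equivalent strictly convex norm which is the dual norm of an
equivalent norm on `E`. -/
def DualAdmitsStrictlyConvexDualNorm (E : Type*) [NormedAddCommGroup E] [NormedSpace ℝ E] :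
    Prop :=
  ∃ (p : Seminorm ℝ E) (q : Seminorm ℝ (StrongDual ℝ E)),
    IsEquivalentNorm p ∧ IsEquivalentNorm q ∧ IsDualNormOf q p ∧ IsStrictlyConvexNorm q

/-! Index pairs of twins by a well-order `Ω` of type `ω₁`, inject `Ω` into the Cantor space by `e`,
and let both twins over `α` have the same image. Each point `x` is made a limit of earlier points:
the piece of its neighbourhoods at level `d` is a neighbourhood of an earlier point whose image
first differs from that of `x` at `d`. The resulting topology refines the one pulled back from the
Cantor space. Twins use disjoint sets of levels, which yields the Hausdorff property, and no basic
neighbourhood contains two twins (`twin_free`), which yields `(*)` and the `G_δ`-diagonal.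
Well-foundedness gives compact neighbourhoods and scatteredness.

Not Gruenhage: a Gruenhage space of size at most continuum has a countable separating family of open
sets (`IsGruenhage.exists_countable_separating`). Under CH all sequences of points are listed in
type `ω₁`, and the ladder can be built so that every sequence listed and contained below `α` whose
images accumulate at that of `α` accumulates at both twins over `α` (`exists_isSaturated`). Given
countably many open sets, the complement of each contains a sequence dense in it for the Cantor
topology. For `α` beyond all these sequences, no set of the family separates the twins over `α`.

Strict convexity: on functions vanishing at infinity a functional is an absolutely summable family
of atoms (`exists_atoms`). For each finite binary word, consider the functions supported over its
cylinder with Euclidean norm at most one on every pair of twins. Along the branch of `r` the support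
functions of these sets tend to the Euclidean norm of the two atoms over `r`
(`tendsto_supOn_branch`). There are only countably many words, so a weighted `ℓ²`-combination with
the dual norm and the evaluation at `1` is an equivalent dual norm, and it inherits strict convexity
from the Euclidean plane. -/

/-! ### Support functions as dual norms. -/

section SupOn

variable {E : Type*} [NormedAddCommGroup E] [NormedSpace ℝ E]

/-- The support function of a set `B`, evaluated at a functional. -/
noncomputable def supOn (B : Set E) (μ : StrongDual ℝ E) : ℝ := sSup ((fun x => μ x) '' B)

/-- A nonempty, symmetric, norm bounded set. -/
structure IsSymmBounded (B : Set E) (C : ℝ) : Prop where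
  nonempty : B.Nonempty
  neg_mem : ∀ x ∈ B, -x ∈ B
  norm_le : ∀ x ∈ B, ‖x‖ ≤ C

namespace IsSymmBounded

variable {B : Set E} {C : ℝ} (h : IsSymmBounded B C)
include h

theorem apply_le (μ : StrongDual ℝ E) {x : E} (hx : x ∈ B) : μ x ≤ C * ‖μ‖ := by
  have h1 := (le_abs_self (μ x)).trans (μ.le_opNorm x)
  have h2 := mul_le_mul_of_nonneg_left (h.norm_le x hx) (norm_nonneg μ)
  linarith [mul_comm C ‖μ‖]

theorem isLUB (μ : StrongDual ℝ E) : IsLUB ((fun x => μ x) '' B) (supOn B μ) :=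
  isLUB_csSup (h.nonempty.image _) ⟨C * ‖μ‖, by rintro _ ⟨x, hx, rfl⟩; exact h.apply_le μ hx⟩

theorem le_supOn (μ : StrongDual ℝ E) {x : E} (hx : x ∈ B) : μ x ≤ supOn B μ :=
  (h.isLUB μ).1 ⟨x, hx, rfl⟩

theorem supOn_le (μ : StrongDual ℝ E) {M : ℝ} (hM : ∀ x ∈ B, μ x ≤ M) : supOn B μ ≤ M :=
  (h.isLUB μ).2 (by rintro _ ⟨x, hx, rfl⟩; exact hM x hx)

theorem supOn_le_norm (μ : StrongDual ℝ E) : supOn B μ ≤ C * ‖μ‖ :=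
  h.supOn_le μ fun _ hx => h.apply_le μ hx

theorem supOn_nonneg (μ : StrongDual ℝ E) : 0 ≤ supOn B μ := by
  obtain ⟨x, hx⟩ := h.nonempty
  have h1 := h.le_supOn μ hx
  have h2 := h.le_supOn μ (h.neg_mem x hx)
  rw [map_neg] at h2
  linarith

theorem abs_le_supOn (μ : StrongDual ℝ E) {x : E} (hx : x ∈ B) : |μ x| ≤ supOn B μ := by
  have h2 := h.le_supOn μ (h.neg_mem x hx)
  rw [map_neg] at h2
  exact abs_le'.2 ⟨h.le_supOn μ hx, h2⟩

theorem supOn_add_le (μ ν : StrongDual ℝ E) : supOn B (μ + ν) ≤ supOn B μ + supOn B ν :=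
  h.supOn_le _ fun _ hx => add_le_add (h.le_supOn μ hx) (h.le_supOn ν hx)

theorem supOn_smul_le (t : ℝ) (μ : StrongDual ℝ E) : supOn B (t • μ) ≤ |t| * supOn B μ := by
  refine h.supOn_le _ fun x hx => ?_
  calc (t • μ) x = t * μ x := rfl
    _ ≤ |t * μ x| := le_abs_self _
    _ = |t| * |μ x| := abs_mul _ _
    _ ≤ _ := mul_le_mul_of_nonneg_left (h.abs_le_supOn μ hx) (abs_nonneg t)

theorem supOn_smul (t : ℝ) (μ : StrongDual ℝ E) : supOn B (t • μ) = |t| * supOn B μ := by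
  refine le_antisymm (h.supOn_smul_le t μ) ?_
  rcases eq_or_ne t 0 with rfl | ht
  · simpa using h.supOn_nonneg _
  · have h1 := h.supOn_smul_le t⁻¹ (t • μ)
    rw [smul_smul, inv_mul_cancel₀ ht, one_smul, abs_inv] at h1
    have h2 : 0 < |t| := abs_pos.2 ht
    calc |t| * supOn B μ ≤ |t| * (|t|⁻¹ * supOn B (t • μ)) :=
          mul_le_mul_of_nonneg_left h1 h2.le
      _ = supOn B (t • μ) := by rw [← mul_assoc, mul_inv_cancel₀ h2.ne', one_mul]

theorem supOn_midpoint_le (μ ν : StrongDual ℝ E) :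
    supOn B ((1 / 2 : ℝ) • (μ + ν)) ≤ (supOn B μ + supOn B ν) / 2 := by
  rw [h.supOn_smul, abs_of_pos (by norm_num : (0 : ℝ) < 1 / 2)]
  linarith [h.supOn_add_le μ ν]

/-- A support function which is equivalent to the dual norm and strictly convex is an equivalent
strictly convex dual norm. -/
theorem dualAdmitsStrictlyConvexDualNorm {c : ℝ} (hc : 0 < c)
    (hlow : ∀ μ, c * ‖μ‖ ≤ supOn B μ)
    (hsc : ∀ μ ν : StrongDual ℝ E, supOn B μ = supOn B ν →
      supOn B ν = supOn B ((1 / 2 : ℝ) • (μ + ν)) → μ = ν) :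
    DualAdmitsStrictlyConvexDualNorm E := by
  have hC : 0 ≤ C := (norm_nonneg _).trans (h.norm_le _ h.nonempty.choose_spec)
  -- The predual norm `p` is the gauge of the bipolar of `B`: the supremum over the polar of `B`.
  -- Thus `B` itself need be neither convex nor closed.
  let D : E → Set ℝ := fun x => {r | ∃ μ : StrongDual ℝ E, supOn B μ ≤ 1 ∧ μ x = r}
  have hμ : ∀ μ : StrongDual ℝ E, supOn B μ ≤ 1 → ‖μ‖ ≤ c⁻¹ := fun μ h1 => by
    rw [← one_div, le_div_iff₀ hc, mul_comm]; exact (hlow μ).trans h1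
  have hDle : ∀ x, ∀ r ∈ D x, r ≤ c⁻¹ * ‖x‖ := by
    rintro x r ⟨μ, h1, rfl⟩
    exact (le_abs_self _).trans ((μ.le_opNorm x).trans
      (mul_le_mul_of_nonneg_right (hμ μ h1) (norm_nonneg x)))
  have hD0 : ∀ x, (0 : ℝ) ∈ D x := fun x => ⟨0, by
    have := h.supOn_smul 0 0
    rw [zero_smul, abs_zero, zero_mul] at this
    rw [this]; exact zero_le_one, rfl⟩
  have hlub : ∀ x, IsLUB (D x) (sSup (D x)) := fun x =>
    isLUB_csSup ⟨0, hD0 x⟩ ⟨_, hDle x⟩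
  have hle : ∀ x (μ : StrongDual ℝ E), supOn B μ ≤ 1 → μ x ≤ sSup (D x) := fun x μ h1 =>
    (hlub x).1 ⟨μ, h1, rfl⟩
  have hsle : ∀ (t : ℝ) x, sSup (D (t • x)) ≤ |t| * sSup (D x) := by
    intro t x
    refine (hlub _).2 ?_
    rintro r ⟨μ, h1, rfl⟩
    have h2 : |μ x| ≤ sSup (D x) := by
      refine abs_le'.2 ⟨hle x μ h1, ?_⟩
      exact hle x (-μ) (h.supOn_le _ fun y hy => by
        have := h.le_supOn μ (h.neg_mem y hy)
        rw [map_neg] at this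
        exact this.trans h1)
    calc μ (t • x) = t * μ x := by rw [map_smul, smul_eq_mul]
      _ ≤ |t * μ x| := le_abs_self _
      _ = |t| * |μ x| := abs_mul _ _
      _ ≤ _ := mul_le_mul_of_nonneg_left h2 (abs_nonneg t)
  let p : Seminorm ℝ E := Seminorm.ofSMulLE (fun x => sSup (D x))
    (by
      refine le_antisymm ((hlub 0).2 ?_) ((hlub 0).1 (hD0 0))
      rintro r ⟨μ, -, rfl⟩
      exact (map_zero μ).le)
    (by
      intro x y
      refine (hlub _).2 ?_
      rintro r ⟨μ, h1, rfl⟩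
      rw [map_add]
      exact add_le_add (hle x μ h1) (hle y μ h1))
    hsle
  let q : Seminorm ℝ (StrongDual ℝ E) := Seminorm.of (supOn B) h.supOn_add_le h.supOn_smul
  -- Normalise `μ` to lie in the polar of `B`; if its support value is zero, `hlow` forces `μ = 0`.
  have hmain : ∀ x (μ : StrongDual ℝ E), μ x ≤ supOn B μ * p x := by
    intro x μ
    rcases (h.supOn_nonneg μ).eq_or_lt with h0 | h0
    · have h1 : ‖μ‖ = 0 := by
        have := hlow μ
        rw [← h0] at this
        exact le_antisymm (by by_contra hh; push Not at hh; nlinarith) (norm_nonneg μ)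
      rw [norm_eq_zero] at h1
      subst h1
      rw [← h0, zero_mul]; exact le_rfl
    · have h1 := hle x ((supOn B μ)⁻¹ • μ) (by
        rw [h.supOn_smul, abs_of_pos (inv_pos.2 h0), inv_mul_cancel₀ h0.ne'])
      have h2 : (supOn B μ)⁻¹ * μ x ≤ p x := h1
      rwa [inv_mul_le_iff₀ h0] at h2
  refine ⟨p, q, ⟨(C + 1)⁻¹, c⁻¹, by positivity, by positivity, fun x => ⟨?_, ?_⟩⟩,
    ⟨c, C + 1, hc, by positivity, fun μ => ⟨hlow μ, ?_⟩⟩, ?_, fun μ ν => hsc μ ν⟩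
  · rcases eq_or_ne x 0 with rfl | hx
    · simp
    obtain ⟨g, hg, hgx⟩ := exists_dual_vector ℝ x (norm_ne_zero_iff.2 hx)
    have h1 := hmain x g
    have h2 := h.supOn_le_norm g
    rw [hg, mul_one] at h2
    have h3 : g x = ‖x‖ := by simpa using hgx
    rw [h3] at h1
    rw [inv_mul_le_iff₀ (by positivity)]
    have := apply_nonneg p x
    nlinarith
  · exact (hlub x).2 (hDle x)
  · refine (h.supOn_le_norm μ).trans (mul_le_mul_of_nonneg_right (by linarith) (norm_nonneg μ))
  · intro μ
    refine ⟨?_, fun M hM => h.supOn_le μ fun x hx => hM ⟨x, (hlub x).2 ?_, rfl⟩⟩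
    · rintro r ⟨x, hx, rfl⟩
      refine (hmain x μ).trans ?_
      exact mul_le_of_le_one_right (h.supOn_nonneg μ) hx
    · rintro r ⟨ν, h1, rfl⟩
      exact (h.le_supOn ν hx).trans h1

end IsSymmBounded

end SupOn

/-! ### Countable `ℓ²`-combinations of support functions. -/

section Combine

variable {E : Type*} [NormedAddCommGroup E] [NormedSpace ℝ E] {ι : Type*}

/-- The `w`-weighted `ℓ²`-combination of the sets `B i`. -/
def l2Combination (w : ι → ℝ) (B : ι → Set E) : Set E :=
  {x | ∃ (F : Finset ι) (c : ι → ℝ) (f : ι → E), (∀ i, f i ∈ B i) ∧ ∑ i ∈ F, c i ^ 2 ≤ 1 ∧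
    x = ∑ i ∈ F, (c i * w i) • f i}

variable {w : ι → ℝ} {B : ι → Set E}

theorem IsSymmBounded.l2Combination (hw : Summable w) (hw0 : ∀ i, 0 ≤ w i)
    (hB : ∀ i, IsSymmBounded (B i) 1) : IsSymmBounded (l2Combination w B) (∑' i, w i) where
  nonempty := ⟨0, ∅, 0, fun i => (hB i).nonempty.choose, fun i => (hB i).nonempty.choose_spec,
    by simp, by simp⟩
  neg_mem := by
    rintro _ ⟨F, c, f, hf, hc, rfl⟩
    exact ⟨F, fun i => -c i, f, hf, by simpa using hc, by simp [Finset.sum_neg_distrib]⟩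
  norm_le := by
    rintro _ ⟨F, c, f, hf, hc, rfl⟩
    refine (norm_sum_le _ _).trans (le_trans ?_ (hw.sum_le_tsum F fun i _ => hw0 i))
    refine Finset.sum_le_sum fun i hi => ?_
    have h1 : c i ^ 2 ≤ 1 :=
      (Finset.single_le_sum (f := fun i => c i ^ 2) (fun j _ => sq_nonneg _) hi).trans hc
    have h2 : |c i| ≤ 1 := by rwa [← sq_le_one_iff_abs_le_one]
    rw [norm_smul, Real.norm_eq_abs, abs_mul, abs_of_nonneg (hw0 i)]
    calc |c i| * w i * ‖f i‖ ≤ 1 * w i * 1 := by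
          gcongr
          · exact mul_nonneg zero_le_one (hw0 i)
          · exact hw0 i
          · exact (hB i).norm_le _ (hf i)
      _ = w i := by ring

/-- This is the duality of `ℓ²` with itself: Cauchy–Schwarz bounds the support function from above,
and its equality case, tested on near-maximisers in the sets `B i`, bounds it from below. -/
theorem hasSum_supOn_sq (hw : Summable w) (hw0 : ∀ i, 0 ≤ w i)
    (hB : ∀ i, IsSymmBounded (B i) 1) (μ : StrongDual ℝ E) :
    HasSum (fun i => (w i * supOn (B i) μ) ^ 2) (supOn (l2Combination w B) μ ^ 2) := by
  have hS := IsSymmBounded.l2Combination hw hw0 hB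
  set Q := supOn (l2Combination w B) μ with hQ
  have hQ0 : 0 ≤ Q := hS.supOn_nonneg μ
  set a : ι → ℝ := fun i => w i * supOn (B i) μ with ha
  have ha0 : ∀ i, 0 ≤ a i := fun i => mul_nonneg (hw0 i) ((hB i).supOn_nonneg μ)
  have hfin : ∀ F : Finset ι, ∑ i ∈ F, a i ^ 2 ≤ Q ^ 2 := by
    intro F
    set T := Real.sqrt (∑ i ∈ F, a i ^ 2) with hT
    have hT2 : T ^ 2 = ∑ i ∈ F, a i ^ 2 := Real.sq_sqrt (Finset.sum_nonneg fun i _ => sq_nonneg _)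
    rw [← hT2]
    rcases (show 0 ≤ T from Real.sqrt_nonneg _).eq_or_lt with h0 | h0
    · rw [← h0]; nlinarith
    refine pow_le_pow_left₀ h0.le ?_ 2
    have hW : 0 ≤ ∑ i ∈ F, a i / T * w i :=
      Finset.sum_nonneg fun i _ => mul_nonneg (div_nonneg (ha0 i) h0.le) (hw0 i)
    -- The coefficients `a i / T` are those for which Cauchy–Schwarz is an equality; the last term
    -- is the loss from choosing `f i` only `ε`-optimal.
    have key : ∀ ε > 0, T ≤ Q + ε * ∑ i ∈ F, a i / T * w i := by
      intro ε hε
      have hf : ∀ i, ∃ f ∈ B i, supOn (B i) μ - ε < μ f := by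
        intro i
        obtain ⟨_, ⟨f, hf, rfl⟩, h1, -⟩ :=
          ((hB i).isLUB μ).exists_between (sub_lt_self (supOn (B i) μ) hε)
        exact ⟨f, hf, h1⟩
      choose f hf hf1 using hf
      have h1 := hS.le_supOn μ (x := ∑ i ∈ F, (a i / T * w i) • f i)
        ⟨F, fun i => a i / T, f, hf, by
          simp only [div_pow]
          rw [← Finset.sum_div, ← hT2, div_self (by positivity)], rfl⟩
      rw [map_sum] at h1
      have h2 : ∑ i ∈ F, (a i / T * w i) * (supOn (B i) μ - ε) ≤
          ∑ i ∈ F, μ ((a i / T * w i) • f i) := by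
        refine Finset.sum_le_sum fun i _ => ?_
        rw [map_smul, smul_eq_mul]
        exact mul_le_mul_of_nonneg_left (hf1 i).le
          (mul_nonneg (div_nonneg (ha0 i) h0.le) (hw0 i))
      have h3 : ∑ i ∈ F, (a i / T * w i) * (supOn (B i) μ - ε) =
          T - ε * ∑ i ∈ F, a i / T * w i := by
        simp only [mul_sub, Finset.sum_sub_distrib]
        congr 1
        · have : ∀ i, a i / T * w i * supOn (B i) μ = a i ^ 2 / T := fun i => by
            simp only [ha]; ring
          simp only [this]
          rw [← Finset.sum_div, ← hT2, sq, mul_div_assoc, div_self h0.ne', mul_one]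
        · rw [Finset.mul_sum]
          exact Finset.sum_congr rfl fun i _ => mul_comm _ _
      linarith
    refine le_of_forall_pos_le_add fun δ hδ => ?_
    have := key (δ / (1 + ∑ i ∈ F, a i / T * w i)) (by positivity)
    refine this.trans ?_
    rw [add_le_add_iff_left, div_mul_eq_mul_div, div_le_iff₀ (by positivity)]
    nlinarith
  have hsum : Summable fun i => a i ^ 2 :=
    summable_of_sum_le (fun i => sq_nonneg _) hfin
  have h1 : ∑' i, a i ^ 2 ≤ Q ^ 2 := Real.tsum_le_of_sum_le (fun i => sq_nonneg _) hfin
  have h2 : Q ≤ Real.sqrt (∑' i, a i ^ 2) := by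
    refine hS.supOn_le μ ?_
    rintro _ ⟨F, c, f, hf, hc, rfl⟩
    refine Real.le_sqrt_of_sq_le ?_
    have h3 : μ (∑ i ∈ F, (c i * w i) • f i) = ∑ i ∈ F, c i * (w i * μ (f i)) := by
      rw [map_sum]
      exact Finset.sum_congr rfl fun i _ => by rw [map_smul, smul_eq_mul, mul_assoc]
    rw [h3]
    refine (Finset.sum_mul_sq_le_sq_mul_sq F _ _).trans ?_
    have h4 : ∑ i ∈ F, (w i * μ (f i)) ^ 2 ≤ ∑ i ∈ F, a i ^ 2 := by
      refine Finset.sum_le_sum fun i _ => sq_le_sq' ?_ ?_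
      · have := neg_le_of_abs_le ((hB i).abs_le_supOn μ (hf i))
        have := mul_le_mul_of_nonneg_left this (hw0 i)
        simp only [ha]; linarith
      · exact mul_le_mul_of_nonneg_left ((hB i).le_supOn μ (hf i)) (hw0 i)
    have h5 := hsum.sum_le_tsum F fun i _ => sq_nonneg _
    have h6 : 0 ≤ ∑ i ∈ F, (w i * μ (f i)) ^ 2 := Finset.sum_nonneg fun i _ => sq_nonneg _
    nlinarith
  have h3 : Q ^ 2 ≤ ∑' i, a i ^ 2 := by
    rw [← Real.sq_sqrt (tsum_nonneg fun i => sq_nonneg (a i))]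
    exact pow_le_pow_left₀ hQ0 h2 2
  rw [← le_antisymm h1 h3]
  exact hsum.hasSum

/-- Countably many support functions which jointly detect equality in the sense of strict
convexity, one of them being the dual norm, combine to a strictly convex dual norm. -/
theorem dualAdmitsStrictlyConvexDualNorm_of_family [Encodable ι]
    (hB : ∀ i, IsSymmBounded (B i) 1) (i₀ : ι) (h0 : ∀ x : E, ‖x‖ ≤ 1 → x ∈ B i₀)
    (hsc : ∀ μ ν : StrongDual ℝ E, (∀ i, supOn (B i) μ = supOn (B i) ν) →
      (∀ i, supOn (B i) ν = supOn (B i) ((1 / 2 : ℝ) • (μ + ν))) → μ = ν) :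
    DualAdmitsStrictlyConvexDualNorm E := by
  set w : ι → ℝ := fun i => (1 / 2 : ℝ) ^ Encodable.encode i with hwdef
  have hw : Summable w := summable_geometric_two_encode
  have hwpos : ∀ i, 0 < w i := fun i => by positivity
  have hw0 : ∀ i, 0 ≤ w i := fun i => (hwpos i).le
  have hS := IsSymmBounded.l2Combination hw hw0 hB
  refine hS.dualAdmitsStrictlyConvexDualNorm (hwpos i₀) ?_ ?_
  · intro μ
    have h1 : ‖μ‖ ≤ supOn (B i₀) μ := by
      refine ContinuousLinearMap.opNorm_le_of_unit_norm ((hB i₀).supOn_nonneg μ) fun x hx => ?_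
      exact (hB i₀).abs_le_supOn μ (h0 x hx.le)
    refine (mul_le_mul_of_nonneg_left h1 (hw0 i₀)).trans ?_
    refine le_of_sq_le_sq ?_ (hS.supOn_nonneg μ)
    exact le_hasSum (hasSum_supOn_sq hw hw0 hB μ) i₀ fun i _ => sq_nonneg _
  · intro μ ν h1 h2
    have hμ := hasSum_supOn_sq hw hw0 hB μ
    have hν := hasSum_supOn_sq hw hw0 hB ν
    have hm := hasSum_supOn_sq hw hw0 hB ((1 / 2 : ℝ) • (μ + ν))
    have hsum := ((hμ.add hν).div_const 2).sub hm
    rw [← h2, h1, add_self_div_two, sub_self] at hsum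
    -- By `(s² + t²)/2 - ((s + t)/2)² = ((s - t)/2)²` and the triangle inequality, each convexity
    -- defect is nonnegative. The defects sum to zero, so all of them vanish.
    have hineq : ∀ i, w i ^ 2 * ((supOn (B i) μ - supOn (B i) ν) / 2) ^ 2 ≤
        ((w i * supOn (B i) μ) ^ 2 + (w i * supOn (B i) ν) ^ 2) / 2 -
          (w i * supOn (B i) ((1 / 2 : ℝ) • (μ + ν))) ^ 2 := by
      intro i
      have h3 := pow_le_pow_left₀ ((hB i).supOn_nonneg _) ((hB i).supOn_midpoint_le μ ν) 2
      have h4 := mul_le_mul_of_nonneg_left h3 (sq_nonneg (w i))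
      nlinarith
    have hzero := (hasSum_zero_iff_of_nonneg fun i =>
      (mul_nonneg (sq_nonneg (w i)) (sq_nonneg _)).trans (hineq i)).1 hsum
    have hmn : ∀ i, supOn (B i) μ = supOn (B i) ν := by
      intro i
      have h3 := hineq i
      have h4 := congrFun hzero i
      simp only [Pi.zero_apply] at h4
      rw [h4] at h3
      have h5 : ((supOn (B i) μ - supOn (B i) ν) / 2) ^ 2 ≤ 0 :=
        nonpos_of_mul_nonpos_right h3 (pow_pos (hwpos i) 2)
      have h6 := pow_eq_zero_iff (two_ne_zero) |>.1 (le_antisymm h5 (sq_nonneg _))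
      linarith
    refine hsc μ ν hmn fun i => ?_
    have h4 := congrFun hzero i
    simp only [Pi.zero_apply, hmn i, add_self_div_two, mul_pow, ← mul_sub] at h4
    rcases mul_eq_zero.1 h4 with h5 | h5
    · exact absurd h5 (pow_pos (hwpos i) 2).ne'
    · exact (pow_left_inj₀ ((hB i).supOn_nonneg _) ((hB i).supOn_nonneg _) two_ne_zero).1
        (sub_eq_zero.1 h5)

end Combine

/-! ### The topology of a ladder of twins. -/

/-- Data for a topology on `Ω × Bool`: an injection `e` of the well-ordered set `Ω` into the
Cantor space, and for every point `x` a partial sequence `g x` of earlier points which approximate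
`x` with respect to `e`, the approximations of the twins `(α, false)`, `(α, true)` living at
disjoint sets of levels. -/
structure TwinLadder (Ω : Type*) [LinearOrder Ω] where
  /-- The injection into the Cantor space. -/
  e : Ω → ℕ → Bool
  /-- The partial sequence of approximations of a point. -/
  g : Ω × Bool → ℕ → Option (Ω × Bool)
  e_injective : Function.Injective e
  lt_of_g : ∀ {x d y}, g x d = some y → y.1 < x.1
  agree_of_g : ∀ {x d y}, g x d = some y → ∀ k < d, e y.1 k = e x.1 k
  ne_of_g : ∀ {x d y}, g x d = some y → e y.1 d ≠ e x.1 d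
  g_disjoint : ∀ {α i j d y z}, g (α, i) d = some y → g (α, j) d = some z → i = j

namespace TwinLadder

variable {Ω : Type*} [LinearOrder Ω]

/-- The point set of the space attached to a ladder. -/
def Space (_ : TwinLadder Ω) : Type _ := Ω × Bool

variable (L : TwinLadder Ω)

/-- `L.Mem x n z` says that `z` lies in the `n`-th basic neighbourhood of `x`. -/
inductive Mem : L.Space → ℕ → L.Space → Prop
  | self (x : L.Space) (n : ℕ) : Mem x n x
  | step {x : L.Space} {n d : ℕ} {y z : L.Space} (hd : n ≤ d) (hg : L.g x d = some y)
      (hz : Mem y (d + 1) z) : Mem x n z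

/-- The `n`-th basic neighbourhood of `x`. -/
def nbhd (x : L.Space) (n : ℕ) : Set L.Space := {z | L.Mem x n z}

variable {L}

theorem self_mem_nbhd (x : L.Space) (n : ℕ) : x ∈ L.nbhd x n := Mem.self x n

theorem mem_nbhd_iff {x z : L.Space} {n : ℕ} :
    z ∈ L.nbhd x n ↔ z = x ∨ ∃ d ≥ n, ∃ y, L.g x d = some y ∧ z ∈ L.nbhd y (d + 1) := by
  constructor
  · rintro (_ | ⟨hd, hg, hz⟩)
    · exact Or.inl rfl
    · exact Or.inr ⟨_, hd, _, hg, hz⟩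
  · rintro (rfl | ⟨d, hd, y, hg, hz⟩)
    · exact Mem.self _ _
    · exact Mem.step hd hg hz

theorem nbhd_antitone (x : L.Space) : Antitone (L.nbhd x) := by
  intro m n hmn z hz
  rw [mem_nbhd_iff] at hz ⊢
  exact hz.imp_right fun ⟨d, hd, h⟩ => ⟨d, hmn.trans hd, h⟩

theorem nbhd_subset_of_g {x y : L.Space} {n d : ℕ} (hd : n ≤ d) (hg : L.g x d = some y) :
    L.nbhd y (d + 1) ⊆ L.nbhd x n := fun _ hz => Mem.step hd hg hz

theorem agree_of_mem {x z : L.Space} {n : ℕ} (h : z ∈ L.nbhd x n) :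
    ∀ k < n, L.e z.1 k = L.e x.1 k := by
  induction h with
  | self => exact fun _ _ => rfl
  | step hd hg _ ih =>
    intro k hk
    rw [ih k (by omega), L.agree_of_g hg k (by omega)]

theorem lt_of_mem {x z : L.Space} {n : ℕ} (h : z ∈ L.nbhd x n) : z = x ∨ z.1 < x.1 := by
  induction h with
  | self => exact Or.inl rfl
  | step hd hg _ ih =>
    refine Or.inr ?_
    rcases ih with rfl | ih
    · exact L.lt_of_g hg
    · exact ih.trans (L.lt_of_g hg)

/-- The points of the `d`-th piece of a neighbourhood of `x` first differ from `x` at `d`. -/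
theorem ne_of_mem_piece {x y z : L.Space} {d : ℕ} (hg : L.g x d = some y)
    (hz : z ∈ L.nbhd y (d + 1)) : L.e z.1 d ≠ L.e x.1 d := by
  rw [agree_of_mem hz d d.lt_succ_self]
  exact L.ne_of_g hg

theorem agree_of_mem_piece {x y z : L.Space} {d : ℕ} (hg : L.g x d = some y)
    (hz : z ∈ L.nbhd y (d + 1)) {k : ℕ} (hk : k < d) : L.e z.1 k = L.e x.1 k := by
  rw [agree_of_mem hz k (by omega), L.agree_of_g hg k hk]

/-- The level of the piece containing `z` is the first place where `L.e z.1` and `L.e x.1` differ,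
so it depends on first coordinates only. The shift to `d + 1` in `Mem.step` keeps the whole piece
different from `x` at `d`. -/
theorem level_eq {x x' y y' z z' : L.Space} {d d' : ℕ} (hx : x.1 = x'.1) (hzz : z.1 = z'.1)
    (hg : L.g x d = some y) (hz : z ∈ L.nbhd y (d + 1))
    (hg' : L.g x' d' = some y') (hz' : z' ∈ L.nbhd y' (d' + 1)) : d = d' := by
  rcases lt_trichotomy d d' with h | h | h
  · exact absurd (hzz ▸ hx ▸ agree_of_mem_piece hg' hz' h) (ne_of_mem_piece hg hz)
  · exact h
  · exact absurd (hzz ▸ hx ▸ agree_of_mem_piece hg hz h) (ne_of_mem_piece hg' hz')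

/-- Twins have the same image under `L.e`, so they would lie in the same piece of `x`, hence in a
neighbourhood of one earlier point; induction descends to a centre, whose twin is absent because all
other points are strictly earlier. -/
theorem twin_free {x z z' : L.Space} {n : ℕ} (h : z ∈ L.nbhd x n) (h' : z' ∈ L.nbhd x n)
    (hzz : z.1 = z'.1) : z = z' := by
  induction h with
  | self =>
    rcases lt_of_mem h' with h | h
    · exact h.symm
    · exact absurd hzz h.ne'
  | @step x n d y z hd hg hz ih =>
    rcases mem_nbhd_iff.1 h' with rfl | ⟨d', -, y', hg', hz'⟩
    · rcases lt_of_mem hz with h | h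
      · exact absurd hzz (h ▸ (L.lt_of_g hg).ne)
      · exact absurd hzz (h.trans (L.lt_of_g hg)).ne
    · obtain rfl := level_eq rfl hzz hg hz hg' hz'
      obtain rfl := Option.some_injective _ (hg.symm.trans hg')
      exact ih hz' hzz

instance : TopologicalSpace L.Space where
  IsOpen U := ∀ x ∈ U, ∃ n, L.nbhd x n ⊆ U
  isOpen_univ _ _ := ⟨0, Set.subset_univ _⟩
  isOpen_inter U V hU hV x hx := by
    obtain ⟨m, hm⟩ := hU x hx.1
    obtain ⟨n, hn⟩ := hV x hx.2
    exact ⟨max m n, Set.subset_inter ((nbhd_antitone x (le_max_left m n)).trans hm)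
      ((nbhd_antitone x (le_max_right m n)).trans hn)⟩
  isOpen_sUnion S hS x := by
    rintro ⟨U, hU, hx⟩
    obtain ⟨n, hn⟩ := hS U hU x hx
    exact ⟨n, hn.trans (Set.subset_sUnion_of_mem hU)⟩

theorem isOpen_iff {U : Set L.Space} : IsOpen U ↔ ∀ x ∈ U, ∃ n, L.nbhd x n ⊆ U := Iff.rfl

theorem isOpen_nbhd (x : L.Space) (n : ℕ) : IsOpen (L.nbhd x n) := by
  rw [isOpen_iff]
  intro z hz
  induction hz with
  | self x n => exact ⟨n, subset_rfl⟩
  | step hd hg _ ih =>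
    obtain ⟨m, hm⟩ := ih
    exact ⟨m, hm.trans (nbhd_subset_of_g hd hg)⟩

theorem hasBasis_nhds (x : L.Space) : (nhds x).HasBasis (fun _ : ℕ => True) (L.nbhd x) := by
  refine ⟨fun U => ?_⟩
  rw [mem_nhds_iff]
  constructor
  · rintro ⟨V, hVU, hV, hx⟩
    obtain ⟨n, hn⟩ := isOpen_iff.1 hV x hx
    exact ⟨n, trivial, hn.trans hVU⟩
  · rintro ⟨n, -, hn⟩
    exact ⟨_, hn, isOpen_nbhd x n, self_mem_nbhd x n⟩

instance : FirstCountableTopology L.Space :=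
  ⟨fun x => (hasBasis_nhds x).isCountablyGenerated⟩

theorem exists_ne_of_fst_ne {x y : L.Space} (h : x.1 ≠ y.1) : ∃ d, L.e x.1 d ≠ L.e y.1 d :=
  Function.ne_iff.1 (L.e_injective.ne h)

theorem disjoint_of_ne {x y : L.Space} {d : ℕ} (h : L.e x.1 d ≠ L.e y.1 d) :
    Disjoint (L.nbhd x (d + 1)) (L.nbhd y (d + 1)) := by
  rw [Set.disjoint_left]
  intro z hx hy
  exact h ((agree_of_mem hx d d.lt_succ_self).symm.trans (agree_of_mem hy d d.lt_succ_self))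

/-- A common point other than the centres would enter both neighbourhoods at the same level, which
`g_disjoint` forbids. -/
theorem disjoint_twins {x y : L.Space} (h : x.1 = y.1) (hne : x ≠ y) (m n : ℕ) :
    Disjoint (L.nbhd x m) (L.nbhd y n) := by
  have hmix : ∀ {x y : L.Space} {n : ℕ}, x.1 = y.1 → x ≠ y → x ∉ L.nbhd y n := by
    intro x y n h hne hx
    rcases lt_of_mem hx with h1 | h1
    · exact hne h1
    · exact h1.ne h
  rw [Set.disjoint_left]
  intro z hx hy
  rcases mem_nbhd_iff.1 hx with rfl | ⟨d, -, u, hg, hz⟩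
  · exact hmix h hne hy
  rcases mem_nbhd_iff.1 hy with rfl | ⟨d', -, u', hg', hz'⟩
  · exact hmix h.symm hne.symm hx
  obtain rfl := level_eq h rfl hg hz hg' hz'
  obtain ⟨α, i⟩ := x
  obtain ⟨β, j⟩ := y
  obtain rfl : α = β := h
  exact hne (by rw [L.g_disjoint hg hg'])

instance : T2Space L.Space := by
  refine ⟨fun x y hxy => ?_⟩
  by_cases h : x.1 = y.1
  · exact ⟨_, _, isOpen_nbhd x 0, isOpen_nbhd y 0, self_mem_nbhd x 0, self_mem_nbhd y 0,
      disjoint_twins h hxy 0 0⟩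
  · obtain ⟨d, hd⟩ := exists_ne_of_fst_ne h
    exact ⟨_, _, isOpen_nbhd x _, isOpen_nbhd y _, self_mem_nbhd x _, self_mem_nbhd y _,
      disjoint_of_ne hd⟩

/-- The `d`-th piece of the neighbourhoods of `x`. -/
def piece (x : L.Space) (d : ℕ) : Set L.Space := {z | ∃ y, L.g x d = some y ∧ z ∈ L.nbhd y (d + 1)}

theorem piece_of_some {x y : L.Space} {d : ℕ} (hg : L.g x d = some y) :
    piece x d = L.nbhd y (d + 1) := by
  ext z
  exact ⟨fun ⟨y', hg', hz⟩ => Option.some_injective _ (hg.symm.trans hg') ▸ hz,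
    fun hz => ⟨y, hg, hz⟩⟩

theorem piece_of_none {x : L.Space} {d : ℕ} (hg : L.g x d = none) : piece x d = ∅ := by
  ext z
  simp [piece, hg]

theorem nbhd_eq_piece_union (x : L.Space) (n : ℕ) :
    L.nbhd x n = piece x n ∪ L.nbhd x (n + 1) := by
  ext z
  rw [Set.mem_union, mem_nbhd_iff, mem_nbhd_iff]
  constructor
  · rintro (h | ⟨d, hd, h⟩)
    · exact Or.inr (Or.inl h)
    · rcases hd.eq_or_lt with rfl | hd
      · exact Or.inl h
      · exact Or.inr (Or.inr ⟨d, hd, h⟩)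
  · rintro (h | h | ⟨d, hd, h⟩)
    · exact Or.inr ⟨n, le_rfl, h⟩
    · exact Or.inl h
    · exact Or.inr ⟨d, by omega, h⟩

theorem disjoint_piece_nbhd (x : L.Space) (n : ℕ) : Disjoint (piece x n) (L.nbhd x (n + 1)) := by
  rw [Set.disjoint_left]
  rintro z ⟨y, hg, hz⟩ hx
  exact ne_of_mem_piece hg hz (agree_of_mem hx n n.lt_succ_self)

section WellFounded

variable [WellFoundedLT Ω]

/-- Induction along the well-order of first coordinates. -/
theorem Space.induction {P : L.Space → Prop}
    (h : ∀ x : L.Space, (∀ y : L.Space, y.1 < x.1 → P y) → P x)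
    (x : L.Space) : P x :=
  (InvImage.wf (fun x : L.Space => x.1) (wellFounded_lt : WellFounded (α := Ω) (· < ·))).induction
    x h

/-- By induction every piece is compact. An ultrafilter on `L.nbhd x n` either contains all `L.nbhd
x N` and converges to `x`, or lives on the finitely many pieces outside one of them. -/
theorem isCompact_nbhd (x : L.Space) : ∀ n, IsCompact (L.nbhd x n) := by
  induction x using Space.induction with
  | h x ih =>
  have hp : ∀ d, IsCompact (piece x d) := fun d => by
    rcases hg : L.g x d with _ | y
    · rw [piece_of_none hg]; exact isCompact_empty
    · rw [piece_of_some hg]; exact ih y (L.lt_of_g hg) _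
  have hcover : ∀ n N, L.nbhd x n ⊆ (⋃ d ∈ Finset.Ico n N, piece x d) ∪ L.nbhd x N := by
    intro n N z hz
    rcases mem_nbhd_iff.1 hz with rfl | ⟨d, hd, h⟩
    · exact Or.inr (self_mem_nbhd _ _)
    · rcases lt_or_ge d N with hdN | hdN
      · exact Or.inl (Set.mem_biUnion (Finset.mem_coe.2 (Finset.mem_Ico.2 ⟨hd, hdN⟩)) h)
      · exact Or.inr (mem_nbhd_iff.2 (Or.inr ⟨d, hdN, h⟩))
  have hsub : ∀ n N, (⋃ d ∈ Finset.Ico n N, piece x d) ⊆ L.nbhd x n := by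
    intro n N
    refine Set.iUnion₂_subset fun d hd => ?_
    rintro z ⟨y, hg, hz⟩
    exact nbhd_subset_of_g (Finset.mem_Ico.1 hd).1 hg hz
  intro n
  rw [isCompact_iff_ultrafilter_le_nhds]
  intro f hf
  rw [Filter.le_principal_iff] at hf
  by_cases hx : ∀ N, L.nbhd x N ∈ f
  · exact ⟨x, self_mem_nbhd x n, (hasBasis_nhds x).ge_iff.2 fun N _ => hx N⟩
  · push Not at hx
    obtain ⟨N, hN⟩ := hx
    have h1 := (Ultrafilter.union_mem_iff.1
      (Filter.mem_of_superset hf (hcover n N))).resolve_right hN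
    obtain ⟨z, hz, hfz⟩ := (isCompact_iff_ultrafilter_le_nhds.1
      ((Finset.Ico n N).isCompact_biUnion fun d _ => hp d)) f (Filter.le_principal_iff.2 h1)
    exact ⟨z, hsub n N hz, hfz⟩

theorem isClopen_nbhd (x : L.Space) (n : ℕ) : IsClopen (L.nbhd x n) :=
  ⟨(isCompact_nbhd x n).isClosed, isOpen_nbhd x n⟩

instance : LocallyCompactSpace L.Space :=
  .of_hasBasis hasBasis_nhds fun x n _ => isCompact_nbhd x n

/-- A point with minimal first coordinate is isolated, since its neighbourhoods add only strictly
earlier points. -/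
theorem isScatteredSpace : IsScatteredSpace L.Space := by
  intro S hS
  obtain ⟨x, hx, hmin⟩ := (InvImage.wf (fun x : L.Space => x.1)
    (wellFounded_lt : WellFounded (α := Ω) (· < ·))).has_min S hS
  refine ⟨x, hx, L.nbhd x 0, isOpen_nbhd x 0, Set.eq_singleton_iff_unique_mem.2
    ⟨⟨hx, self_mem_nbhd x 0⟩, ?_⟩⟩
  rintro z ⟨hz, hz'⟩
  exact (lt_of_mem hz').resolve_right (hmin z hz)

end WellFounded

/-! ### Separation by levels: the `G_δ`-diagonal and property `(*)`. -/

/-- No two distinct points lie in a common `n`-th neighbourhood for every `n`. -/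
theorem exists_separating_level {y z : L.Space} (h : y ≠ z) :
    ∃ n, ∀ x : L.Space, y ∈ L.nbhd x n → z ∉ L.nbhd x n := by
  by_cases hyz : y.1 = z.1
  · exact ⟨0, fun x hy hz => h (twin_free hy hz hyz)⟩
  · obtain ⟨d, hd⟩ := exists_ne_of_fst_ne hyz
    exact ⟨d + 1, fun x hy hz => hd ((agree_of_mem hy d d.lt_succ_self).trans
      (agree_of_mem hz d d.lt_succ_self).symm)⟩

theorem isGδ_diagonal : IsGδ (Set.diagonal L.Space) := by
  have : Set.diagonal L.Space = ⋂ n, ⋃ x, L.nbhd x n ×ˢ L.nbhd x n := by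
    ext ⟨y, z⟩
    simp only [Set.mem_diagonal_iff, Set.mem_iInter, Set.mem_iUnion, Set.mem_prod]
    constructor
    · rintro rfl n
      exact ⟨y, self_mem_nbhd y n, self_mem_nbhd y n⟩
    · intro h
      by_contra hne
      obtain ⟨n, hn⟩ := exists_separating_level hne
      obtain ⟨x, hy, hz⟩ := h n
      exact hn x hy hz
  rw [this]
  exact .iInter_of_isOpen fun n => isOpen_iUnion fun x => (isOpen_nbhd x n).prod (isOpen_nbhd x n)

/-- The `n`-th family consists of all `n`-th basic neighbourhoods. It covers every finite point, and
no member contains infinity, so level `0` handles pairs involving infinity. -/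
theorem hasStar_onePoint [WellFoundedLT Ω] : HasStar (OnePoint L.Space) := by
  refine ⟨fun n => Set.range fun x => ((↑) : L.Space → OnePoint L.Space) '' L.nbhd x n, ?_, ?_⟩
  · rintro n _ ⟨x, rfl⟩
    exact OnePoint.isOpen_image_coe.2 (isOpen_nbhd x n)
  · have key : ∀ (y : L.Space) (n : ℕ) (q : OnePoint L.Space),
        ({(y : OnePoint L.Space), q} ∩ ⋃₀ (Set.range fun x =>
          ((↑) : L.Space → OnePoint L.Space) '' L.nbhd x n)).Nonempty := fun y n q =>
      ⟨y, Or.inl rfl, _, ⟨y, rfl⟩, y, self_mem_nbhd y n, rfl⟩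
    have hinf : ∀ y : L.Space, ∀ U ∈ (Set.range fun x =>
        ((↑) : L.Space → OnePoint L.Space) '' L.nbhd x 0),
        ({(y : OnePoint L.Space), OnePoint.infty} ∩ U).Subsingleton := by
      rintro y _ ⟨x, rfl⟩ a ⟨rfl | rfl, u, -, hu⟩ b ⟨rfl | rfl, v, -, hv⟩
      · rfl
      · exact absurd hv (OnePoint.coe_ne_infty v)
      · exact absurd hu (OnePoint.coe_ne_infty u)
      · rfl
    intro p q hpq
    induction p using OnePoint.rec with
    | infty =>
      induction q using OnePoint.rec with
      | infty => exact absurd rfl hpq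
      | coe z =>
        rw [Set.pair_comm]
        exact ⟨0, key z 0 _, hinf z⟩
    | coe y =>
      induction q using OnePoint.rec with
      | infty => exact ⟨0, key y 0 _, hinf y⟩
      | coe z =>
        obtain ⟨n, hn⟩ := exists_separating_level (L := L) fun h => hpq (congrArg _ h)
        refine ⟨n, key y n _, ?_⟩
        rintro _ ⟨x, rfl⟩ a ⟨rfl | rfl, u, hu, hu'⟩ b ⟨rfl | rfl, v, hv, hv'⟩
        · rfl
        · obtain rfl := OnePoint.coe_injective hu'
          obtain rfl := OnePoint.coe_injective hv'
          exact absurd hv (hn x hu)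
        · obtain rfl := OnePoint.coe_injective hu'
          obtain rfl := OnePoint.coe_injective hv'
          exact absurd hu (hn x hv)
        · rfl

end TwinLadder

/-! ### Scattered compactifications and the Gruenhage property. -/

theorem IsScatteredSpace.onePoint {X : Type*} [TopologicalSpace X] (h : IsScatteredSpace X) :
    IsScatteredSpace (OnePoint X) := by
  intro S hS
  rcases ((↑) ⁻¹' S : Set X).eq_empty_or_nonempty with h0 | h1
  · refine ⟨OnePoint.infty, ?_, Set.univ, isOpen_univ, ?_⟩
    all_goals
      have hsub : ∀ p ∈ S, p = OnePoint.infty := by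
        intro p hp
        induction p using OnePoint.rec with
        | infty => rfl
        | coe y => exact absurd (show y ∈ ((↑) ⁻¹' S : Set X) from hp) (h0 ▸ Set.notMem_empty y)
      obtain ⟨p, hp⟩ := hS
    · exact hsub p hp ▸ hp
    · rw [Set.inter_univ]
      exact Set.eq_singleton_iff_unique_mem.2 ⟨hsub p hp ▸ hp, hsub⟩
  · obtain ⟨x, hx, U, hU, hSU⟩ := h _ h1
    refine ⟨x, hx, (↑) '' U, OnePoint.isOpen_image_coe.2 hU, ?_⟩
    rw [← Set.image_singleton, ← hSU, Set.inter_comm, ← Set.image_inter_preimage, Set.inter_comm]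

theorem IsGruenhage.of_isOpenEmbedding {X Y : Type*} [TopologicalSpace X] [TopologicalSpace Y]
    {f : X → Y} (hf : Topology.IsOpenEmbedding f) (h : IsGruenhage Y) : IsGruenhage X := by
  obtain ⟨𝒰, R, ho, hs, hR⟩ := h
  refine ⟨fun n => (f ⁻¹' ·) '' 𝒰 n, fun n => f ⁻¹' R n, ?_, ?_, ?_⟩
  · rintro n _ ⟨U, hU, rfl⟩
    exact (ho n U hU).preimage hf.continuous
  · intro x y hxy
    obtain ⟨n, U, hU, z, hz⟩ := hs (f x) (f y) (hf.injective.ne hxy)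
    have hzm : z ∈ {f x, f y} ∩ U := hz ▸ rfl
    have hw : ∃ w ∈ ({x, y} : Set X), f w = z := by
      rcases hzm.1 with h | h
      · exact ⟨x, Or.inl rfl, h.symm⟩
      · exact ⟨y, Or.inr rfl, h.symm⟩
    obtain ⟨w, hw, rfl⟩ := hw
    refine ⟨n, _, ⟨U, hU, rfl⟩, w, Set.eq_singleton_iff_unique_mem.2 ⟨⟨hw, hzm.2⟩, ?_⟩⟩
    rintro v ⟨hv, hvU⟩
    refine hf.injective ?_
    have : f v ∈ {f x, f y} ∩ U := ⟨by rcases hv with rfl | rfl <;> simp, hvU⟩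
    rw [hz] at this
    exact this
  · rintro n _ ⟨U, hU, rfl⟩ _ ⟨V, hV, rfl⟩ hne
    change f ⁻¹' (U ∩ V) = _
    rw [hR n U hU V hV fun h => hne (by rw [h])]

/-- In a Gruenhage space of size at most continuum, countably many open sets separate points. -/
theorem IsGruenhage.exists_countable_separating {X : Type*} [TopologicalSpace X]
    (h : IsGruenhage X) {φ : X → ℕ → Bool} (hφ : Function.Injective φ) :
    ∃ 𝒪 : Set (Set X), 𝒪.Countable ∧ (∀ O ∈ 𝒪, IsOpen O) ∧
      ∀ x y : X, x ≠ y → ∃ O ∈ 𝒪, ¬(x ∈ O ↔ y ∈ O) := by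
  classical
  obtain ⟨𝒰, R, ho, hs, hR⟩ := h
  rcases isEmpty_or_nonempty X with hX | ⟨⟨x₀⟩⟩
  · exact ⟨∅, Set.countable_empty, by simp, fun x => hX.elim x⟩
  let σ : ℕ → Set X → X := fun n U => if hU : (U \ R n).Nonempty then hU.choose else x₀
  have hσ : ∀ n U x, x ∈ U → x ∉ R n → σ n U ∈ U \ R n := by
    intro n U x hx hxR
    have hU : (U \ R n).Nonempty := ⟨x, hx, hxR⟩
    simp only [σ, dif_pos hU]
    exact hU.choose_spec
  let W : ℕ × ℕ × Bool → Set X := fun t => ⋃₀ {U ∈ 𝒰 t.1 | φ (σ t.1 U) t.2.1 = t.2.2}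
  refine ⟨Set.range (fun n => ⋃₀ 𝒰 n) ∪ Set.range (fun n => interior (R n)) ∪ Set.range W,
    ((Set.countable_range _).union (Set.countable_range _)).union (Set.countable_range _), ?_, ?_⟩
  · rintro _ ((⟨n, rfl⟩ | ⟨n, rfl⟩) | ⟨t, rfl⟩)
    · exact isOpen_sUnion (ho n)
    · exact isOpen_interior
    · exact isOpen_sUnion fun U hU => ho _ U hU.1
  · have key : ∀ x y : X, (∃ n, ∃ U ∈ 𝒰 n, x ∈ U ∧ y ∉ U) →
        ∃ O ∈ Set.range (fun n => ⋃₀ 𝒰 n) ∪ Set.range (fun n => interior (R n)) ∪ Set.range W,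
          ¬(x ∈ O ↔ y ∈ O) := by
      rintro x y ⟨n, U, hU, hxU, hyU⟩
      -- If `y` lies outside the union, the union separates. Otherwise `y` is in some `V ≠ U` but
      -- not in `R n`; then `interior (R n)` separates if `x ∈ V`, and a bit distinguishing the
      -- labels of `U` and `V` does so if not.
      by_cases hy : y ∈ ⋃₀ 𝒰 n
      · obtain ⟨V, hV, hyV⟩ := hy
        have hUV : U ≠ V := fun h => hyU (h ▸ hyV)
        have hRn := hR n U hU V hV hUV
        have hyR : y ∉ R n := fun hy => hyU (hRn ▸ hy : y ∈ U ∩ V).1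
        by_cases hxV : x ∈ V
        · refine ⟨_, Or.inl (Or.inr ⟨n, rfl⟩), fun h => hyR (interior_subset (h.1 ?_))⟩
          have : IsOpen (R n) := hRn ▸ (ho n U hU).inter (ho n V hV)
          change x ∈ interior (R n)
          rw [this.interior_eq, ← hRn]
          exact ⟨hxU, hxV⟩
        · have hxR : x ∉ R n := fun hx => hxV (hRn ▸ hx : x ∈ U ∩ V).2
          have h1 := hσ n U x hxU hxR
          have h2 := hσ n V y hyV hyR
          have h3 : σ n U ≠ σ n V := fun h => h1.2 (hRn ▸ ⟨h1.1, h ▸ h2.1⟩)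
          obtain ⟨k, hk⟩ := Function.ne_iff.1 (hφ.ne h3)
          refine ⟨_, Or.inr ⟨(n, k, φ (σ n U) k), rfl⟩, fun h => ?_⟩
          obtain ⟨V', ⟨hV', hk'⟩, hyV'⟩ := h.1 ⟨U, ⟨hU, rfl⟩, hxU⟩
          -- A second member through `y` would put `y` in `R n`.
          have hVV' : V ≠ V' := by
            rintro rfl
            exact hk hk'.symm
          exact hyR (hR n V hV V' hV' hVV' ▸ ⟨hyV, hyV'⟩)
      · exact ⟨_, Or.inl (Or.inl ⟨n, rfl⟩), fun h => hy (h.1 ⟨U, hU, hxU⟩)⟩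
    intro x y hxy
    obtain ⟨n, U, hU, z, hz⟩ := hs x y hxy
    have hzm : z ∈ {x, y} ∩ U := hz ▸ rfl
    have huniq : ∀ w ∈ ({x, y} : Set X), w ∈ U → w = z := fun w hw hwU => by
      have : w ∈ {x, y} ∩ U := ⟨hw, hwU⟩
      rw [hz] at this
      exact this
    rcases hzm.1 with rfl | rfl
    · exact key z y ⟨n, U, hU, hzm.2, fun hy => hxy (huniq y (Or.inr rfl) hy).symm⟩
    · obtain ⟨O, hO, h⟩ := key z x ⟨n, U, hU, hzm.2, fun hx => hxy (huniq x (Or.inl rfl) hx)⟩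
      exact ⟨O, hO, fun h' => h h'.symm⟩

/-! ### Functionals and disjoint clopen sets. -/

open Filter Topology

section Indicator

variable {K : Type*} [TopologicalSpace K]

open scoped Classical in
/-- The continuous characteristic function of a clopen set. -/
noncomputable def clopenInd (A : Set K) : C(K, ℝ) :=
  if h : IsClopen A then ⟨A.indicator 1, h.continuous_indicator continuous_one⟩ else 0

open scoped Classical in
theorem clopenInd_apply {A : Set K} (h : IsClopen A) (p : K) :
    clopenInd A p = if p ∈ A then 1 else 0 := by
  rw [clopenInd, dif_pos h]
  simp [Set.indicator_apply]

theorem clopenInd_of_mem {A : Set K} (h : IsClopen A) {p : K} (hp : p ∈ A) :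
    clopenInd A p = 1 := by rw [clopenInd_apply h, if_pos hp]

theorem clopenInd_of_notMem {A : Set K} (h : IsClopen A) {p : K} (hp : p ∉ A) :
    clopenInd A p = 0 := by rw [clopenInd_apply h, if_neg hp]

theorem clopenInd_union {A B : Set K} (hA : IsClopen A) (hB : IsClopen B) (hAB : Disjoint A B) :
    clopenInd (A ∪ B) = clopenInd A + clopenInd B := by
  ext p
  rw [ContinuousMap.add_apply, clopenInd_apply (hA.union hB), clopenInd_apply hA,
    clopenInd_apply hB]
  by_cases h1 : p ∈ A
  · have := Set.disjoint_left.1 hAB h1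
    simp [h1, this]
  · rw [if_neg h1, zero_add]
    by_cases h2 : p ∈ B
    · rw [if_pos (show p ∈ A ∪ B from Or.inr h2), if_pos h2]
    · rw [if_neg (show p ∉ A ∪ B from not_or.2 ⟨h1, h2⟩), if_neg h2]

/-- Test `Λ` on the signed sum of the characteristic functions, which has norm at most one by
disjointness. -/
theorem sum_abs_clopenInd_le [CompactSpace K] (Λ : StrongDual ℝ C(K, ℝ)) {ι : Type*}
    (F : Finset ι) (A : ι → Set K) (hA : ∀ i, IsClopen (A i))
    (hd : ∀ i ∈ F, ∀ j ∈ F, i ≠ j → Disjoint (A i) (A j)) :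
    ∑ i ∈ F, |Λ (clopenInd (A i))| ≤ ‖Λ‖ := by
  classical
  set c : ι → ℝ := fun i => if 0 ≤ Λ (clopenInd (A i)) then 1 else -1 with hc
  have habs : ∀ i, |c i| = 1 := fun i => by simp only [hc]; split_ifs <;> simp
  have hmul : ∀ i, c i * Λ (clopenInd (A i)) = |Λ (clopenInd (A i))| := fun i => by
    simp only [hc]
    split_ifs with h
    · rw [one_mul, abs_of_nonneg h]
    · rw [neg_one_mul, abs_of_neg (not_le.1 h)]
  have hf : ‖∑ i ∈ F, c i • clopenInd (A i)‖ ≤ 1 := by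
    refine (ContinuousMap.norm_le _ zero_le_one).2 fun p => ?_
    rw [ContinuousMap.coe_sum, Finset.sum_apply]
    by_cases hp : ∃ i ∈ F, p ∈ A i
    · obtain ⟨i, hi, hpi⟩ := hp
      rw [Finset.sum_eq_single_of_mem i hi fun j hj hij => by
        rw [ContinuousMap.smul_apply, clopenInd_of_notMem (hA j)
          (Set.disjoint_left.1 (hd i hi j hj hij.symm) hpi), smul_zero]]
      rw [ContinuousMap.smul_apply, clopenInd_of_mem (hA i) hpi, smul_eq_mul, mul_one,
        Real.norm_eq_abs, habs]
    · push Not at hp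
      rw [Finset.sum_eq_zero fun i hi => by
        rw [ContinuousMap.smul_apply, clopenInd_of_notMem (hA i) (hp i hi), smul_zero]]
      simp
  calc ∑ i ∈ F, |Λ (clopenInd (A i))| = Λ (∑ i ∈ F, c i • clopenInd (A i)) := by
        rw [map_sum]
        exact Finset.sum_congr rfl fun i _ => by rw [map_smul, smul_eq_mul, hmul]
    _ ≤ ‖Λ (∑ i ∈ F, c i • clopenInd (A i))‖ := le_abs_self _
    _ ≤ ‖Λ‖ * 1 := (Λ.le_opNorm _).trans (mul_le_mul_of_nonneg_left hf (norm_nonneg _))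
    _ = ‖Λ‖ := mul_one _

end Indicator

/-! ### Functionals on the compactification as families of atoms. -/

namespace TwinLadder

variable {Ω : Type*} [LinearOrder Ω] {L : TwinLadder Ω}

variable (L) in
/-- The characteristic function of a basic neighbourhood, on the one-point compactification. -/
noncomputable def ind (x : L.Space) (n : ℕ) : C(OnePoint L.Space, ℝ) :=
  clopenInd ((↑) '' L.nbhd x n)

/-- The characteristic function of a piece, on the one-point compactification. -/
noncomputable def pieceInd (x : L.Space) (d : ℕ) : C(OnePoint L.Space, ℝ) :=
  clopenInd ((↑) '' piece x d)

theorem pieceInd_of_some {x y : L.Space} {d : ℕ} (hg : L.g x d = some y) :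
    pieceInd x d = L.ind y (d + 1) := by rw [pieceInd, piece_of_some hg, ind]

theorem eventually_disjoint {x y : L.Space} (h : x ≠ y) :
    ∀ᶠ n in atTop, Disjoint (L.nbhd x n) (L.nbhd y n) := by
  by_cases hxy : x.1 = y.1
  · exact Eventually.of_forall fun n => disjoint_twins hxy h n n
  · obtain ⟨d, hd⟩ := exists_ne_of_fst_ne hxy
    filter_upwards [eventually_ge_atTop (d + 1)] with n hn
    exact (disjoint_of_ne hd).mono (nbhd_antitone x hn) (nbhd_antitone y hn)

theorem eventually_notMem {x y : L.Space} (h : y ≠ x) : ∀ᶠ n in atTop, y ∉ L.nbhd x n := by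
  filter_upwards [eventually_disjoint h] with n hn
  exact Set.disjoint_left.1 hn (self_mem_nbhd y n)

theorem eventually_nbhd_subset {x : L.Space} {U : Set L.Space} (hU : U ∈ 𝓝 x) :
    ∀ᶠ n in atTop, L.nbhd x n ⊆ U := by
  obtain ⟨m, -, hm⟩ := (hasBasis_nhds x).mem_iff.1 hU
  filter_upwards [eventually_ge_atTop m] with n hn
  exact (nbhd_antitone x hn).trans hm

theorem disjoint_piece {x : L.Space} {d d' : ℕ} (h : d ≠ d') :
    Disjoint (piece x d) (piece x d') := by
  rw [Set.disjoint_left]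
  rintro z ⟨y, hg, hz⟩ ⟨y', hg', hz'⟩
  exact h (level_eq rfl rfl hg hz hg' hz')

theorem summable_mul_apply {a : L.Space → ℝ} (ha : Summable fun x => |a x|)
    (f : C(OnePoint L.Space, ℝ)) : Summable fun x : L.Space => a x * f x := by
  refine Summable.of_norm_bounded (ha.mul_right ‖f‖) fun x => ?_
  rw [norm_mul, Real.norm_eq_abs]
  exact mul_le_mul_of_nonneg_left (f.norm_coe_le_norm x) (abs_nonneg _)

/-- The functional given by a summable family of point masses. -/
noncomputable def atomic (a : L.Space → ℝ) (ha : Summable fun x => |a x|) :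
    StrongDual ℝ C(OnePoint L.Space, ℝ) :=
  LinearMap.mkContinuous
    { toFun := fun f => ∑' x : L.Space, a x * f x
      map_add' := fun f g => by
        rw [← (summable_mul_apply ha f).tsum_add (summable_mul_apply ha g)]
        exact tsum_congr fun x => by rw [ContinuousMap.add_apply, mul_add]
      map_smul' := fun t f => by
        rw [RingHom.id_apply, smul_eq_mul, ← tsum_mul_left]
        exact tsum_congr fun x => by
          rw [ContinuousMap.smul_apply, smul_eq_mul, mul_left_comm] }
    (∑' x, |a x|) fun f => by
      rw [← tsum_mul_right]
      refine tsum_of_norm_bounded (ha.mul_right ‖f‖).hasSum fun x => ?_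
      rw [norm_mul, Real.norm_eq_abs]
      exact mul_le_mul_of_nonneg_left (f.norm_coe_le_norm x) (abs_nonneg _)

theorem atomic_apply (a : L.Space → ℝ) (ha : Summable fun x => |a x|)
    (f : C(OnePoint L.Space, ℝ)) : atomic a ha f = ∑' x : L.Space, a x * f x := rfl

variable [WellFoundedLT Ω]

theorem isClopen_image_nbhd (x : L.Space) (n : ℕ) :
    IsClopen ((↑) '' L.nbhd x n : Set (OnePoint L.Space)) :=
  ⟨((isCompact_nbhd x n).image OnePoint.continuous_coe).isClosed,
    OnePoint.isOpen_image_coe.2 (isOpen_nbhd x n)⟩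

open scoped Classical in
theorem ind_coe (x z : L.Space) (n : ℕ) : L.ind x n z = if z ∈ L.nbhd x n then 1 else 0 := by
  rw [ind, clopenInd_apply (isClopen_image_nbhd x n)]
  simp [OnePoint.coe_injective.mem_set_image]

theorem ind_infty (x : L.Space) (n : ℕ) : L.ind x n OnePoint.infty = 0 :=
  clopenInd_of_notMem (isClopen_image_nbhd x n) (by simp)

theorem isClopen_image_piece (x : L.Space) (d : ℕ) :
    IsClopen ((↑) '' piece x d : Set (OnePoint L.Space)) := by
  rcases hg : L.g x d with _ | y
  · rw [piece_of_none hg, Set.image_empty]; exact isClopen_empty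
  · rw [piece_of_some hg]; exact isClopen_image_nbhd y _

theorem pieceInd_of_none {x : L.Space} {d : ℕ} (hg : L.g x d = none) :
    pieceInd x d = 0 := by
  ext p
  rw [pieceInd, clopenInd_of_notMem (isClopen_image_piece x d) (by simp [piece_of_none hg])]
  rfl

theorem ind_eq_add (x : L.Space) (n : ℕ) : L.ind x n = pieceInd x n + L.ind x (n + 1) := by
  rw [ind, nbhd_eq_piece_union, Set.image_union, clopenInd_union (isClopen_image_piece x n)
    (isClopen_image_nbhd x _) (Set.disjoint_image_of_injective OnePoint.coe_injective
      (disjoint_piece_nbhd x n))]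
  rfl

/-- Functionals on the space of continuous functions have atoms. -/
theorem exists_tendsto_ind (Λ : StrongDual ℝ C(OnePoint L.Space, ℝ)) (x : L.Space) :
    ∃ a, Tendsto (fun n => Λ (L.ind x n)) atTop (𝓝 a) := by
  have h1 : Summable fun d => |Λ (pieceInd x d)| := by
    refine summable_of_sum_le (c := ‖Λ‖) (fun _ => abs_nonneg _) fun F => ?_
    exact sum_abs_clopenInd_le Λ F _ (isClopen_image_piece x) fun i _ j _ hij =>
      Set.disjoint_image_of_injective OnePoint.coe_injective (disjoint_piece hij)
  have h2 := h1.of_abs.hasSum.tendsto_sum_nat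
  -- The neighbourhoods shrink by one piece at a time, so the sequence telescopes into partial sums
  -- of an absolutely convergent series.
  have h3 : ∀ n, Λ (L.ind x n) = Λ (L.ind x 0) - ∑ d ∈ Finset.range n, Λ (pieceInd x d) := by
    intro n
    induction n with
    | zero => simp
    | succ n ih =>
      rw [Finset.sum_range_succ, ← sub_sub, ← ih, ind_eq_add x n, map_add]
      ring
  exact ⟨_, (tendsto_const_nhds.sub h2).congr fun n => (h3 n).symm⟩

/-- Finitely many distinct points eventually have disjoint neighbourhoods, so the bound by `‖Λ‖`
passes to the limit. -/
theorem summable_atoms (Λ : StrongDual ℝ C(OnePoint L.Space, ℝ)) {a : L.Space → ℝ}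
    (ha : ∀ x, Tendsto (fun n => Λ (L.ind x n)) atTop (𝓝 (a x))) : Summable fun x => |a x| := by
  refine summable_of_sum_le (c := ‖Λ‖) (fun _ => abs_nonneg _) fun F => ?_
  have h1 : Tendsto (fun n => ∑ x ∈ F, |Λ (L.ind x n)|) atTop (𝓝 (∑ x ∈ F, |a x|)) :=
    tendsto_finsetSum _ fun x _ => (ha x).abs
  refine le_of_tendsto h1 ?_
  have h2 : ∀ᶠ n in atTop, ∀ x ∈ F, ∀ y ∈ F, x ≠ y → Disjoint (L.nbhd x n) (L.nbhd y n) := by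
    rw [F.eventually_all]
    intro x _
    rw [F.eventually_all]
    intro y _
    by_cases hxy : x = y
    · exact Eventually.of_forall fun _ h => absurd hxy h
    · exact (eventually_disjoint hxy).mono fun _ h _ => h
  filter_upwards [h2] with n hn
  exact sum_abs_clopenInd_le Λ F _ (fun x => isClopen_image_nbhd x n) fun i hi j hj hij =>
    Set.disjoint_image_of_injective OnePoint.coe_injective (hn i hi j hj hij)

theorem tendsto_atomic_ind {a : L.Space → ℝ} (ha : Summable fun x => |a x|) (x : L.Space) :
    Tendsto (fun n => atomic a ha (L.ind x n)) atTop (𝓝 (a x)) := by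
  classical
  simp only [atomic_apply]
  rw [← tsum_ite_eq x a]
  refine tendsto_tsum_of_dominated_convergence ha (fun y => ?_) (Eventually.of_forall fun n y => ?_)
  · refine tendsto_nhds_of_eventually_eq ?_
    by_cases hy : y = x
    · subst hy
      exact Eventually.of_forall fun n => by rw [ind_coe, if_pos (self_mem_nbhd y n)]; simp
    · filter_upwards [eventually_notMem hy] with n hn
      rw [ind_coe, if_neg hn, if_neg hy, mul_zero]
  · rw [ind_coe, Real.norm_eq_abs, abs_mul]
    split_ifs <;> simp

/-- Pieces are neighbourhoods of earlier points, so by induction `ν` kills them and the value does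
not depend on `n`. By continuity of `f` at `x` its limit is `f x` times the atom of `ν` at `x`,
which is zero. -/
theorem apply_mul_ind_eq_zero {ν : StrongDual ℝ C(OnePoint L.Space, ℝ)}
    (hν : ∀ x, Tendsto (fun n => ν (L.ind x n)) atTop (𝓝 0)) (f : C(OnePoint L.Space, ℝ))
    (x : L.Space) : ∀ n, ν (f * L.ind x n) = 0 := by
  induction x using Space.induction with
  | h x ih =>
  have hp : ∀ d, ν (f * pieceInd x d) = 0 := fun d => by
    rcases hg : L.g x d with _ | y
    · rw [pieceInd_of_none hg, mul_zero, map_zero]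
    · rw [pieceInd_of_some hg]; exact ih y (L.lt_of_g hg) _
  have hstep : ∀ n, ν (f * L.ind x n) = ν (f * L.ind x 0) := by
    intro n
    induction n with
    | zero => rfl
    | succ n ihn => rw [← ihn, ind_eq_add x n, mul_add, map_add, hp, zero_add]
  have hlim : Tendsto (fun n => f * L.ind x n - f x • L.ind x n) atTop (𝓝 0) := by
    rw [Metric.tendsto_nhds]
    intro ε hε
    have hU : {z : L.Space | dist (f z) (f x) < ε / 2} ∈ 𝓝 x :=
      (f.continuous.comp OnePoint.continuous_coe).continuousAt.eventually
        (Metric.ball_mem_nhds _ (half_pos hε))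
    filter_upwards [eventually_nbhd_subset hU] with n hn
    rw [dist_zero_right]
    refine lt_of_le_of_lt ((ContinuousMap.norm_le _ (half_pos hε).le).2 fun p => ?_)
      (half_lt_self hε)
    rw [ContinuousMap.sub_apply, ContinuousMap.mul_apply, ContinuousMap.smul_apply, smul_eq_mul,
      ← sub_mul]
    induction p using OnePoint.rec with
    | infty => rw [ind_infty, mul_zero, norm_zero]; positivity
    | coe z =>
      rw [ind_coe]
      split_ifs with hz
      · rw [mul_one]; exact (hn hz).le
      · rw [mul_zero, norm_zero]; positivity
  have h1 := (ν.continuous.tendsto 0).comp hlim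
  have h2 := h1.add ((hν x).const_mul (f x))
  rw [map_zero, mul_zero, zero_add] at h2
  have h3 : Tendsto (fun _ : ℕ => ν (f * L.ind x 0)) atTop (𝓝 0) := by
    refine h2.congr fun n => ?_
    rw [Function.comp_apply, map_sub, map_smul, smul_eq_mul, sub_add_cancel, hstep]
  intro n
  rw [hstep, tendsto_nhds_unique tendsto_const_nhds h3]

/-- The set where `|f| ≥ ε` is a compact subset of the space, covered by finitely many basic
neighbourhoods. Multiplying `f` by the complements' characteristic functions leaves `ν f` unchanged
and makes the norm at most `ε`. -/
theorem apply_eq_zero_of_atomless {ν : StrongDual ℝ C(OnePoint L.Space, ℝ)}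
    (hν : ∀ x, Tendsto (fun n => ν (L.ind x n)) atTop (𝓝 0)) (f : C(OnePoint L.Space, ℝ))
    (hf : f OnePoint.infty = 0) : ν f = 0 := by
  have hprod : ∀ (t : Finset L.Space), ν (f * ∏ x ∈ t, (1 - L.ind x 0)) = ν f := by
    classical
    intro t
    induction t using Finset.induction_on with
    | empty => simp
    | insert x t hx ih =>
      rw [Finset.prod_insert hx, mul_left_comm, sub_mul, one_mul, map_sub, ih, mul_comm,
        apply_mul_ind_eq_zero hν, sub_zero]
  have hle : ∀ ε > 0, |ν f| ≤ ‖ν‖ * ε := by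
    intro ε hε
    have hopen : IsOpen {p : OnePoint L.Space | |f p| < ε} :=
      isOpen_lt f.continuous.abs continuous_const
    have hcpt : IsCompact {z : L.Space | ε ≤ |f z|} := by
      have := (OnePoint.isOpen_iff_of_mem (show OnePoint.infty ∈ {p | |f p| < ε} by
        simpa [hf] using hε)).1 hopen
      convert this.2 using 1
      ext z
      simp
    obtain ⟨t, ht⟩ := hcpt.elim_nhds_subcover (fun x => L.nbhd x 0) fun x _ =>
      (isOpen_nbhd x 0).mem_nhds (self_mem_nbhd x 0)
    rw [← hprod t]
    refine (ν.le_opNorm _).trans (mul_le_mul_of_nonneg_left ?_ (norm_nonneg _))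
    refine (ContinuousMap.norm_le _ hε.le).2 fun p => ?_
    rw [ContinuousMap.mul_apply, ContinuousMap.coe_prod, Finset.prod_apply, norm_mul]
    induction p using OnePoint.rec with
    | infty => rw [hf, norm_zero, zero_mul]; exact hε.le
    | coe z =>
      by_cases hz : ε ≤ |f z|
      · obtain ⟨x, hx, hzx⟩ := Set.mem_iUnion₂.1 (ht.2 hz)
        rw [Finset.prod_eq_zero hx, norm_zero, mul_zero]
        · exact hε.le
        · rw [ContinuousMap.sub_apply, ind_coe, if_pos hzx, ContinuousMap.one_apply, sub_self]
      · refine (mul_le_mul (not_le.1 hz).le ?_ (norm_nonneg _) hε.le).trans (mul_one ε).le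
        rw [norm_prod]
        refine Finset.prod_le_one (fun x _ => norm_nonneg _) fun x _ => ?_
        rw [ContinuousMap.sub_apply, ContinuousMap.one_apply, ind_coe]
        split_ifs <;> simp
  by_contra hne
  have h0 : 0 < |ν f| := abs_pos.2 hne
  have := hle (|ν f| / (2 * (‖ν‖ + 1))) (by positivity)
  rw [mul_div_assoc', le_div_iff₀ (by positivity)] at this
  nlinarith [norm_nonneg ν]

/-- Functionals are given by point masses on functions vanishing at infinity. -/
theorem exists_atoms (Λ : StrongDual ℝ C(OnePoint L.Space, ℝ)) :
    ∃ a : L.Space → ℝ, (Summable fun x => |a x|) ∧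
      ∀ f : C(OnePoint L.Space, ℝ), f OnePoint.infty = 0 → Λ f = ∑' x : L.Space, a x * f x := by
  choose a ha using exists_tendsto_ind Λ
  have hs := summable_atoms Λ ha
  refine ⟨a, hs, fun f hf => ?_⟩
  have h1 : ∀ x, Tendsto (fun n => (Λ - atomic a hs) (L.ind x n)) atTop (𝓝 0) := fun x => by
    simpa using (ha x).sub (tendsto_atomic_ind hs x)
  exact sub_eq_zero.1 (apply_eq_zero_of_atomless h1 f hf)

end TwinLadder

/-! ### The strictly convex dual norm. -/

namespace TwinLadder

variable {Ω : Type*} [LinearOrder Ω] {L : TwinLadder Ω}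

variable (L) in
/-- The point over `r` with second coordinate `i`. -/
def point (r : Ω) (i : Bool) : L.Space := (r, i)

@[simp]
theorem point_fst (r : Ω) (i : Bool) : (L.point r i).1 = r := rfl

@[simp]
theorem point_inj {r s : Ω} {i j : Bool} : L.point r i = L.point s j ↔ r = s ∧ i = j :=
  Prod.ext_iff

theorem exists_eq_point (x : L.Space) : ∃ r i, x = L.point r i := ⟨x.1, x.2, rfl⟩

variable (L) in
/-- The functions supported over the cylinder of a finite binary sequence `s` whose restrictions
to pairs of twins have Euclidean norm at most one. -/
def cylinderBall (s : Σ n, Fin n → Bool) : Set C(OnePoint L.Space, ℝ) :=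
  {f | f OnePoint.infty = 0 ∧ (∀ x : L.Space, f x ≠ 0 → ∀ k : Fin s.1, L.e x.1 k = s.2 k) ∧
    ∀ r : Ω, f (L.point r false) ^ 2 + f (L.point r true) ^ 2 ≤ 1}

variable (L) in
/-- The sets whose support functions are combined to a strictly convex dual norm. -/
def normingFamily : Option (Option (Σ n, Fin n → Bool)) → Set C(OnePoint L.Space, ℝ)
  | none => Metric.closedBall 0 1
  | some none => {1, -1}
  | some (some s) => L.cylinderBall s

theorem isSymmBounded_cylinderBall (s : Σ n, Fin n → Bool) :
    IsSymmBounded (L.cylinderBall s) 1 where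
  nonempty := ⟨0, by simp [cylinderBall]⟩
  neg_mem := by
    rintro f ⟨h1, h2, h3⟩
    refine ⟨by simp [h1], fun x hx => h2 x (by simpa using hx), fun r => by simpa using h3 r⟩
  norm_le := by
    rintro f ⟨h1, -, h3⟩
    refine (ContinuousMap.norm_le _ zero_le_one).2 fun p => ?_
    induction p using OnePoint.rec with
    | infty => simp [h1]
    | coe z =>
      obtain ⟨r, i, rfl⟩ := exists_eq_point z
      rw [Real.norm_eq_abs, ← sq_le_one_iff_abs_le_one]
      cases i
      · exact (le_add_of_nonneg_right (sq_nonneg _)).trans (h3 r)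
      · exact (le_add_of_nonneg_left (sq_nonneg _)).trans (h3 r)

theorem isSymmBounded_normingFamily (i : Option (Option (Σ n, Fin n → Bool))) :
    IsSymmBounded (L.normingFamily i) 1 := by
  rcases i with _ | _ | s
  · exact ⟨⟨0, by simp [normingFamily]⟩, fun f hf => by simpa [normingFamily] using hf,
      fun f hf => by simpa [normingFamily] using hf⟩
  · refine ⟨⟨1, Or.inl rfl⟩, ?_, ?_⟩
    · rintro f (rfl | rfl)
      · exact Or.inr rfl
      · exact Or.inl (neg_neg _)
    · rintro f (rfl | rfl)
      · simp
      · simp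
  · exact isSymmBounded_cylinderBall s

theorem supOn_one (Λ : StrongDual ℝ C(OnePoint L.Space, ℝ)) :
    supOn (L.normingFamily (some none)) Λ = |Λ 1| := by
  have h := isSymmBounded_normingFamily (L := L) (some none)
  refine le_antisymm (h.supOn_le Λ ?_) (h.abs_le_supOn Λ (Or.inl rfl))
  rintro f (rfl | rfl)
  · exact le_abs_self _
  · rw [map_neg]; exact neg_le_abs _

/-- The two neighbourhoods are disjoint and neither contains a pair of twins, so each of `u` and `v`
occurs at most once over `r`. This makes the combination a test function for `cylinderBall`. -/
theorem sq_add_sq_twins_le {x y : L.Space} {N : ℕ} (hxy : x.1 = y.1) (hne : x ≠ y) {u v : ℝ}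
    [WellFoundedLT Ω] (huv : u ^ 2 + v ^ 2 ≤ 1) :
    ∀ r : Ω, (u • L.ind x N + v • L.ind y N) (L.point r false) ^ 2 +
      (u • L.ind x N + v • L.ind y N) (L.point r true) ^ 2 ≤ 1 := by
  intro r
  have hd := Set.disjoint_left.1 (disjoint_twins hxy hne N N)
  have ht : ∀ w : L.Space, L.point r false ∈ L.nbhd w N →
      L.point r true ∉ L.nbhd w N := fun w h h' => by
    have := twin_free h h' rfl
    simp at this
  have hu := sq_nonneg u
  have hv := sq_nonneg v
  have hu1 : |u| ≤ 1 := sq_le_one_iff_abs_le_one u |>.1 (by linarith)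
  have hv1 : |v| ≤ 1 := sq_le_one_iff_abs_le_one v |>.1 (by linarith)
  simp only [ContinuousMap.add_apply, ContinuousMap.smul_apply, smul_eq_mul, ind_coe]
  by_cases h1 : L.point r false ∈ L.nbhd x N
  · have h2 := hd h1
    have h3 := ht x h1
    by_cases h4 : L.point r true ∈ L.nbhd y N <;> simp [h1, h2, h3, h4] <;> linarith
  · by_cases h2 : L.point r true ∈ L.nbhd x N
    · have h3 := hd h2
      by_cases h4 : L.point r false ∈ L.nbhd y N <;> simp [h1, h2, h3, h4] <;> linarith
    · by_cases h4 : L.point r false ∈ L.nbhd y N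
      · have h3 := ht y h4
        simp [h1, h2, h3, h4]; linarith
      · by_cases h3 : L.point r true ∈ L.nbhd y N <;> simp [h1, h2, h3, h4]; linarith

/-- The initial segments of the branch of `r`. -/
def branch (L : TwinLadder Ω) (r : Ω) (n : ℕ) : Σ n, Fin n → Bool := ⟨n, fun k => L.e r k⟩

theorem agree_of_branch_eq {r s : Ω} {n : ℕ} (h : L.branch r n = L.branch s n) :
    ∀ k < n, L.e r k = L.e s k := fun k hk =>
  congrFun (eq_of_heq (Sigma.mk.inj h).2) (⟨k, hk⟩ : Fin n)

variable [WellFoundedLT Ω]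

/-- Combine the characteristic functions of small neighbourhoods of the twins over `r`, weighted by
the unit vector in the direction of the two atoms; the values tend to the Euclidean norm. -/
theorem sqrt_le_supOn_branch {Λ : StrongDual ℝ C(OnePoint L.Space, ℝ)} {a : L.Space → ℝ}
    (ha : Summable fun x => |a x|)
    (hΛ : ∀ f : C(OnePoint L.Space, ℝ), f OnePoint.infty = 0 → Λ f = ∑' x : L.Space, a x * f x)
    (r : Ω) (n : ℕ) :
    √(a (L.point r false) ^ 2 + a (L.point r true) ^ 2) ≤
      supOn (L.cylinderBall (L.branch r n)) Λ := by
  have hB := isSymmBounded_cylinderBall (L := L) (L.branch r n)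
  have hlim : ∀ x, Tendsto (fun n => Λ (L.ind x n)) atTop (𝓝 (a x)) := fun x =>
    (tendsto_atomic_ind ha x).congr fun n => (hΛ _ (ind_infty x n)).symm
  set T := √(a (L.point r false) ^ 2 + a (L.point r true) ^ 2) with hT
  have hT2 : T ^ 2 = a (L.point r false) ^ 2 + a (L.point r true) ^ 2 :=
    Real.sq_sqrt (by positivity)
  rcases (show 0 ≤ T from Real.sqrt_nonneg _).eq_or_lt with h0 | h0
  · rw [← h0]; exact hB.supOn_nonneg Λ
  set u := a (L.point r false) / T with hu
  set v := a (L.point r true) / T with hv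
  have huv : u ^ 2 + v ^ 2 ≤ 1 := by
    rw [hu, hv, div_pow, div_pow, ← add_div, ← hT2, div_self (by positivity)]
  have h1 : Tendsto (fun N => Λ (u • L.ind (L.point r false) N + v • L.ind (L.point r true) N))
      atTop (𝓝 T) := by
    have h2 := ((hlim (L.point r false)).const_mul u).add ((hlim (L.point r true)).const_mul v)
    have h3 : u * a (L.point r false) + v * a (L.point r true) = T := by
      rw [hu, hv]
      field_simp
      linarith
    rw [h3] at h2
    refine h2.congr fun N => ?_
    rw [map_add, map_smul, map_smul, smul_eq_mul, smul_eq_mul]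
  refine le_of_tendsto h1 ?_
  filter_upwards [eventually_ge_atTop n] with N hN
  refine hB.le_supOn Λ ⟨by simp [ind_infty], fun x hx k => ?_,
    sq_add_sq_twins_le (L := L) (x := (L.point r false)) (y := (L.point r true)) rfl
      (by simp) huv⟩
  by_contra hk
  have h2 : ∀ i, x ∉ L.nbhd (L.point r i) N := fun i h => hk (agree_of_mem h k (k.2.trans_le hN))
  simp [ind_coe, h2] at hx

theorem tendsto_supOn_branch {Λ : StrongDual ℝ C(OnePoint L.Space, ℝ)} {a : L.Space → ℝ}
    (ha : Summable fun x => |a x|)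
    (hΛ : ∀ f : C(OnePoint L.Space, ℝ), f OnePoint.infty = 0 → Λ f = ∑' x : L.Space, a x * f x)
    (r : Ω) :
    Tendsto (fun n => supOn (L.cylinderBall (L.branch r n)) Λ) atTop
      (𝓝 √(a (L.point r false) ^ 2 + a (L.point r true) ^ 2)) := by
  classical
  set T := √(a (L.point r false) ^ 2 + a (L.point r true) ^ 2) with hT
  -- The mass over the cylinder of length `n` outside the twins over `r`. It tends to zero by
  -- dominated convergence, since `L.e` is injective, and it bounds the excess over `T`.
  set h : ℕ → L.Space → ℝ := fun n x =>
    if (∀ k < n, L.e x.1 k = L.e r k) ∧ x.1 ≠ r then |a x| else 0 with hh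
  have hle : ∀ n x, ‖h n x‖ ≤ |a x| := fun n x => by
    simp only [hh]
    split_ifs <;> simp
  have hsum : ∀ n, Summable (h n) := fun n => Summable.of_norm_bounded ha (hle n)
  have h0 : Tendsto (fun n => ∑' x, h n x) atTop (𝓝 (∑' x : L.Space, (0 : ℝ))) := by
    refine tendsto_tsum_of_dominated_convergence ha (fun x => ?_)
      (Eventually.of_forall fun n x => hle n x)
    refine tendsto_nhds_of_eventually_eq ?_
    by_cases hx : x.1 = r
    · exact Eventually.of_forall fun n => if_neg fun h => h.2 hx
    · obtain ⟨d, hd⟩ := Function.ne_iff.1 (L.e_injective.ne hx)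
      filter_upwards [eventually_gt_atTop d] with n hn
      exact if_neg fun h => hd (h.1 d hn)
  rw [tsum_zero] at h0
  have h1 := h0.const_add T
  rw [add_zero] at h1
  refine tendsto_of_tendsto_of_tendsto_of_le_of_le tendsto_const_nhds h1
    (fun n => sqrt_le_supOn_branch ha hΛ r n) fun n => ?_
  refine (isSymmBounded_cylinderBall (L := L) (L.branch r n)).supOn_le Λ ?_
  intro f hf
  have hfn := (isSymmBounded_cylinderBall (L := L) (L.branch r n)).norm_le f hf
  obtain ⟨hf0, hf1, hf2⟩ := hf
  rw [hΛ f hf0]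
  have hne : (L.point r false) ≠ (L.point r true) := by simp
  set F : Finset L.Space := {(L.point r false), (L.point r true)} with hF
  set b : L.Space → ℝ := fun x => if x.1 = r then a x * f x else 0 with hb
  have hb0 : ∀ x ∉ F, b x = 0 := by
    intro x hx
    obtain ⟨s, i, rfl⟩ := exists_eq_point x
    refine if_neg fun hs => ?_
    obtain rfl : s = r := hs
    cases i <;> simp [hF] at hx
  have hbsum : ∑' x, b x = a (L.point r false) * f (L.point r false) +
      a (L.point r true) * f (L.point r true) := by
    rw [tsum_eq_sum hb0, hF, Finset.sum_pair hne]
    simp [hb]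
  have hbT : ∑' x, b x ≤ T := by
    rw [hbsum]
    -- Cauchy–Schwarz in the plane, through Lagrange's identity.
    refine Real.le_sqrt_of_sq_le ?_
    have := hf2 r
    nlinarith [sq_nonneg (a (L.point r false) * f (L.point r true) -
      a (L.point r true) * f (L.point r false)),
      sq_nonneg (a (L.point r false)), sq_nonneg (a (L.point r true))]
  have hbs : Summable b := summable_of_ne_finset_zero hb0
  refine le_trans ?_ (add_le_add_left hbT _)
  rw [← hbs.tsum_add (hsum n)]
  refine (summable_mul_apply ha f).tsum_le_tsum (fun x => ?_) (hbs.add (hsum n))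
  simp only [hb, hh]
  by_cases hx : x.1 = r
  · simp [hx]
  · by_cases hx2 : ∀ k < n, L.e x.1 k = L.e r k
    · rw [if_neg hx, if_pos ⟨hx2, hx⟩, zero_add]
      refine (le_abs_self _).trans ?_
      rw [abs_mul]
      exact mul_le_of_le_one_right (abs_nonneg _) ((f.norm_coe_le_norm x).trans hfn)
    · rw [if_neg hx, if_neg fun h => hx2 h.1, zero_add]
      by_cases hfx : f x = 0
      · rw [hfx, mul_zero]
      · exact absurd (fun k hk => hf1 x hfx ⟨k, hk⟩) hx2

theorem dualAdmitsStrictlyConvexDualNorm :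
    DualAdmitsStrictlyConvexDualNorm C(OnePoint L.Space, ℝ) := by
  refine dualAdmitsStrictlyConvexDualNorm_of_family (B := L.normingFamily)
    isSymmBounded_normingFamily none (fun f hf => by simpa [normingFamily] using hf) ?_
  intro μ ν h1 h2
  obtain ⟨a, ha, hμ⟩ := exists_atoms μ
  obtain ⟨b, hb, hν⟩ := exists_atoms ν
  have hm : Summable fun x => |(1 / 2 : ℝ) * (a x + b x)| := by
    refine ((ha.of_abs.add hb.of_abs).mul_left (1 / 2)).abs
  have hmid : ∀ f : C(OnePoint L.Space, ℝ), f OnePoint.infty = 0 →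
      ((1 / 2 : ℝ) • (μ + ν)) f = ∑' x : L.Space, (1 / 2 : ℝ) * (a x + b x) * f x := by
    intro f hf
    change (1 / 2 : ℝ) * (μ f + ν f) = _
    rw [hμ f hf, hν f hf, ← (summable_mul_apply ha f).tsum_add (summable_mul_apply hb f),
      ← tsum_mul_left]
    exact tsum_congr fun x => by ring
  have hab : ∀ x, a x = b x := by
    have hr : ∀ r : Ω, a (L.point r false) = b (L.point r false) ∧
        a (L.point r true) = b (L.point r true) := by
      intro r
      have e1 := tendsto_nhds_unique (tendsto_supOn_branch ha hμ r)
        ((tendsto_supOn_branch hb hν r).congr fun n =>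
          (h1 (some (some (L.branch r n)))).symm)
      have e2 := tendsto_nhds_unique (tendsto_supOn_branch hb hν r)
        ((tendsto_supOn_branch hm hmid r).congr fun n =>
          (h2 (some (some (L.branch r n)))).symm)
      rw [Real.sqrt_inj (by positivity) (by positivity)] at e1 e2
      -- The parallelogram law: both pairs of atoms and their midpoint have the same Euclidean norm.
      have e3 : (a (L.point r false) - b (L.point r false)) ^ 2 +
          (a (L.point r true) - b (L.point r true)) ^ 2 = 0 := by
        linarith
      have e4 := sq_nonneg (a (L.point r false) - b (L.point r false))
      have e5 := sq_nonneg (a (L.point r true) - b (L.point r true))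
      constructor
      · exact sub_eq_zero.1 (pow_eq_zero_iff two_ne_zero |>.1 (by linarith))
      · exact sub_eq_zero.1 (pow_eq_zero_iff two_ne_zero |>.1 (by linarith))
    intro x
    obtain ⟨r, _ | _, rfl⟩ := exists_eq_point x
    · exact (hr r).1
    · exact (hr r).2
  have hone : μ 1 = ν 1 := by
    have e1 := h1 (some none)
    have e2 := h2 (some none)
    simp only [supOn_one] at e1 e2
    change |ν 1| = |(1 / 2 : ℝ) * (μ 1 + ν 1)| at e2
    rw [← sq_eq_sq_iff_abs_eq_abs] at e1 e2
    have e3 : (μ 1 - ν 1) ^ 2 = 0 := by linarith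
    exact sub_eq_zero.1 (pow_eq_zero_iff two_ne_zero |>.1 e3)
  ext f
  have hf : f = (f - f OnePoint.infty • (1 : C(OnePoint L.Space, ℝ))) +
    f OnePoint.infty • (1 : C(OnePoint L.Space, ℝ)) := (sub_add_cancel _ _).symm
  have hf0 : (f - f OnePoint.infty • (1 : C(OnePoint L.Space, ℝ))) OnePoint.infty = 0 := by simp
  rw [hf, map_add, map_add, map_smul, map_smul, hone, hμ _ hf0, hν _ hf0]
  simp only [hab]

/-! ### Saturation excludes the Gruenhage property. -/

/-- Every sequence of points which accumulates at `α` with respect to `e`, and which is listed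
before `α`, accumulates at both twins over `α`. -/
def IsSaturated (L : TwinLadder Ω) (ℓ : Ω → ℕ → Ω × Bool) : Prop :=
  ∀ α β, β < α → (∀ m, (ℓ β m).1 < α) → (∀ n, ∃ m, ∀ k < n, L.e (ℓ β m).1 k = L.e α k) →
    ∀ i n, ∃ d ≥ n, ∃ m, L.g (α, i) d = some (ℓ β m)

omit [WellFoundedLT Ω] in
/-- The space of a saturated ladder is not Gruenhage. -/
theorem IsSaturated.not_isGruenhage [Uncountable Ω] (hΩ : ∀ α : Ω, (Set.Iic α).Countable)
    {ℓ : Ω → ℕ → Ω × Bool} (hℓ : Function.Surjective ℓ) (hL : L.IsSaturated ℓ) :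
    ¬ IsGruenhage L.Space := by
  intro hG
  -- Bit `0` records the twin, the later bits the value of `L.e`.
  let φ : L.Space → ℕ → Bool := fun x n => n.casesOn x.2 (L.e x.1)
  have hφ : Function.Injective φ := by
    intro x y hxy
    refine Prod.ext (L.e_injective (funext fun n => congrFun hxy (n + 1))) (congrFun hxy 0)
  obtain ⟨𝒪, h𝒪, hopen, hsep⟩ := hG.exists_countable_separating hφ
  have hdense : ∀ O : Set L.Space, ∃ β, Oᶜ.Nonempty → (∀ m, ℓ β m ∈ Oᶜ) ∧
      ∀ x ∈ Oᶜ, ∀ n, ∃ m, ∀ k < n, L.e (ℓ β m).1 k = L.e x.1 k := by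
    intro O
    rcases (Oᶜ).eq_empty_or_nonempty with h0 | ⟨x₀, hx₀⟩
    · exact ⟨Classical.arbitrary Ω, fun h => absurd h0 h.ne_empty⟩
    classical
    -- One point of the complement over each cylinder that it meets: a countable subset dense for
    -- the Cantor topology.
    let σ : (Σ n, Fin n → Bool) → L.Space := fun s =>
      if h : ∃ x ∈ Oᶜ, L.branch x.1 s.1 = s then h.choose else x₀
    have hσO : ∀ s, σ s ∈ Oᶜ := fun s => by
      simp only [σ]
      split_ifs with h
      · exact h.choose_spec.1
      · exact hx₀
    have hσ : ∀ x ∈ Oᶜ, ∀ n, L.branch (σ (L.branch x.1 n)).1 n = L.branch x.1 n := by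
      intro x hx n
      have h : ∃ y ∈ Oᶜ, L.branch y.1 (L.branch x.1 n).1 = L.branch x.1 n := ⟨x, hx, rfl⟩
      simp only [σ, dif_pos h]
      exact h.choose_spec.2
    obtain ⟨t, ht⟩ := exists_surjective_nat (Σ n, Fin n → Bool)
    obtain ⟨β, hβ⟩ := hℓ fun m => σ (t m)
    refine ⟨β, fun _ => ⟨fun m => hβ ▸ hσO (t m), fun x hx n => ?_⟩⟩
    obtain ⟨m, hm⟩ := ht (L.branch x.1 n)
    refine ⟨m, ?_⟩
    rw [hβ]
    change ∀ k < n, L.e (σ (t m)).1 k = _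
    rw [hm]
    exact agree_of_branch_eq (hσ x hx n)
  choose b hb using hdense
  have hcount : (⋃ O ∈ 𝒪, (Set.Iic (b O) ∪ ⋃ m, Set.Iic (ℓ (b O) m).1)).Countable :=
    h𝒪.biUnion fun O _ => (hΩ _).union (Set.countable_iUnion fun m => hΩ _)
  -- Countably many countable initial segments do not exhaust `Ω`, so some `α` lies beyond all
  -- chosen indices and all terms of the chosen sequences.
  obtain ⟨α, hα⟩ : ∃ α, α ∉ ⋃ O ∈ 𝒪, (Set.Iic (b O) ∪ ⋃ m, Set.Iic (ℓ (b O) m).1) := by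
    by_contra! h
    exact Set.not_countable_univ (hcount.mono fun x _ => h x)
  simp only [Set.mem_iUnion, Set.mem_union, Set.mem_Iic, not_exists, not_or, not_le] at hα
  -- If one twin is outside `O`, the sequence dense in the complement accumulates at `α`, hence by
  -- saturation at the other twin, which therefore cannot lie in the open set `O`.
  have key : ∀ O ∈ 𝒪, ∀ i j, L.point α i ∉ O → L.point α j ∉ O := by
    intro O hO i j hi hj
    obtain ⟨hbO, hacc⟩ := hb O ⟨_, hi⟩
    obtain ⟨n, hn⟩ := isOpen_iff.1 (hopen O hO) _ hj
    obtain ⟨d, hd, m, hg⟩ := hL α (b O) (hα O hO).1 (hα O hO).2 (hacc _ hi) j n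
    exact hbO m (hn (nbhd_subset_of_g hd hg (self_mem_nbhd _ _)))
  obtain ⟨O, hO, h⟩ := hsep (L.point α false) (L.point α true) (by simp)
  exact h (not_iff_not.1 ⟨key O hO _ _, key O hO _ _⟩)

end TwinLadder

/-! ### Construction of a saturated ladder. -/

/-- Countably many infinite sets of natural numbers, with repetitions prescribed, have an
assignment hitting each of them infinitely often. -/
theorem exists_assignment {J : Type*} [Countable J] (A : J → Set ℕ) (hA : ∀ j, (A j).Infinite) :
    ∃ h : ℕ → Option J, (∀ d j, h d = some j → d ∈ A j) ∧ ∀ j n, ∃ d ≥ n, h d = some j := by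
  classical
  rcases isEmpty_or_nonempty J with hJ | hJ
  · exact ⟨fun _ => none, fun d j => hJ.elim j, fun j => hJ.elim j⟩
  -- Enumerating `J × ℕ` makes every `j` recur infinitely often; the strictly increasing `φ` then
  -- gives each occurrence its own level.
  obtain ⟨t, ht⟩ := exists_surjective_nat (J × ℕ)
  obtain ⟨φ, hφ, hφA⟩ := Filter.extraction_forall_of_frequently
    (P := fun n k => k ∈ A (t n).1) fun n => Nat.frequently_atTop_iff_infinite.2 (hA (t n).1)
  refine ⟨fun d => if h : ∃ n, φ n = d then some (t h.choose).1 else none, ?_, ?_⟩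
  · intro d j hd
    simp only [Option.dite_none_right_eq_some] at hd
    obtain ⟨h, hd⟩ := hd
    obtain rfl := Option.some_injective _ hd
    have := hφA h.choose
    rwa [h.choose_spec] at this
  · intro j n
    have hinf : (Set.range fun m : ℕ => (j, m)).Infinite :=
      Set.infinite_range_of_injective fun a b h => by simpa using h
    have hinf2 : (t ⁻¹' Set.range fun m : ℕ => (j, m)).Infinite :=
      hinf.preimage fun x _ => ht x
    obtain ⟨k, ⟨m, hm⟩, hk⟩ := hinf2.exists_gt n
    refine ⟨φ k, hk.le.trans (hφ.id_le k), ?_⟩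
    have h : ∃ n, φ n = φ k := ⟨k, rfl⟩
    simp only [dif_pos h]
    rw [hφ.injective h.choose_spec, ← hm]

/-- For an injection of a well-order of type `ω₁` into the Cantor space, and every list of
sequences, there is a saturated ladder. -/
theorem TwinLadder.exists_isSaturated {Ω : Type*} [LinearOrder Ω] [WellFoundedLT Ω]
    (hΩ : ∀ α : Ω, (Set.Iic α).Countable) (e : Ω → ℕ → Bool) (he : Function.Injective e)
    (ℓ : Ω → ℕ → Ω × Bool) : ∃ L : TwinLadder Ω, L.IsSaturated ℓ := by
  classical
  let T : Ω → Set Ω := fun α => {β | β < α ∧ (∀ m, (ℓ β m).1 < α) ∧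
    ∀ n, ∃ m, ∀ k < n, e (ℓ β m).1 k = e α k}
  -- The levels at which some term of the sequence splits from `α`. Both twins use the same set, and
  -- `exists_assignment` later gives each level to at most one sequence and one twin.
  let A : ∀ α, T α × Bool → Set ℕ := fun α j =>
    {d | ∃ m, (∀ k < d, e (ℓ j.1 m).1 k = e α k) ∧ e (ℓ j.1 m).1 d ≠ e α d}
  have hA : ∀ α j, (A α j).Infinite := by
    rintro α ⟨⟨β, -, hlt, hacc⟩, i⟩
    refine Set.infinite_of_forall_exists_gt fun n => ?_
    -- Agreement below `n + 1` pushes the splitting level strictly above `n`.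
    obtain ⟨m, hm⟩ := hacc (n + 1)
    have hne : ∃ d, e (ℓ β m).1 d ≠ e α d := Function.ne_iff.1 (he.ne (hlt m).ne)
    refine ⟨Nat.find hne, ⟨m, fun k hk => not_not.1 (Nat.find_min hne hk), Nat.find_spec hne⟩, ?_⟩
    by_contra! h
    exact Nat.find_spec hne (hm _ (Nat.lt_succ_of_le h))
  have hT : ∀ α, Countable (T α × Bool) := fun α => by
    have : (T α).Countable := (hΩ α).mono fun β hβ => hβ.1.le
    have := this.to_subtype
    infer_instance
  choose h h1 h2 using fun α => exists_assignment (A α) (hA α)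
  have hg : ∀ (x : Ω × Bool) (d : ℕ), ∃ o : Option (Ω × Bool),
      (∀ y, o = some y → ∃ j m, h x.1 d = some j ∧ j.2 = x.2 ∧ y = ℓ j.1 m ∧
        (∀ k < d, e y.1 k = e x.1 k) ∧ e y.1 d ≠ e x.1 d) ∧
      ∀ j, h x.1 d = some j → j.2 = x.2 → ∃ m, o = some (ℓ j.1 m) := by
    intro x d
    by_cases H : ∃ j, h x.1 d = some j ∧ j.2 = x.2
    · obtain ⟨j, hj, hjx⟩ := H
      obtain ⟨m, hm1, hm2⟩ := h1 x.1 d j hj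
      refine ⟨some (ℓ j.1 m), fun y hy => ?_, fun j' hj' _ => ⟨m, ?_⟩⟩
      · obtain rfl := Option.some_injective _ hy
        exact ⟨j, m, hj, hjx, rfl, hm1, hm2⟩
      · rw [Option.some_injective _ (hj.symm.trans hj')]
    · exact ⟨none, fun y hy => by simp at hy, fun j hj hjx => absurd ⟨j, hj, hjx⟩ H⟩
  choose g hg1 hg2 using hg
  refine ⟨⟨e, g, he, ?_, ?_, ?_, ?_⟩, ?_⟩
  · intro x d y hy
    obtain ⟨j, m, -, -, rfl, -⟩ := hg1 x d y hy
    exact j.1.2.2.1 m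
  · intro x d y hy
    obtain ⟨_, _, -, -, -, h, -⟩ := hg1 x d y hy
    exact h
  · intro x d y hy
    obtain ⟨_, _, -, -, -, -, h⟩ := hg1 x d y hy
    exact h
  · intro α i j d y z hy hz
    obtain ⟨a, -, ha, hai, -⟩ := hg1 _ d y hy
    obtain ⟨b, -, hb, hbj, -⟩ := hg1 _ d z hz
    exact hai.symm.trans ((congrArg _ (Option.some_injective _ (ha.symm.trans hb))).trans hbj)
  · intro α β hβ hlt hacc i n
    obtain ⟨d, hd, hj⟩ := h2 α (⟨β, hβ, hlt, hacc⟩, i) n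
    obtain ⟨m, hm⟩ := hg2 (α, i) d _ hj rfl
    exact ⟨d, hd, m, hm⟩

/-! ### Assembly under the continuum hypothesis. -/

open Cardinal in
theorem mainTheorem3 (CH : Cardinal.aleph.{0} 1 = Cardinal.continuum.{0}) :
    ∃ (X : Type) (_ : TopologicalSpace X),
      (T2Space X ∧ LocallyCompactSpace X ∧ IsScatteredSpace X ∧
        FirstCountableTopology X ∧ IsGδ (Set.diagonal X) ∧ ¬ IsGruenhage X) ∧
      (CompactSpace (OnePoint X) ∧ T2Space (OnePoint X) ∧
        IsScatteredSpace (OnePoint X) ∧ ¬ IsGruenhage (OnePoint X) ∧ HasStar (OnePoint X)) ∧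
      DualAdmitsStrictlyConvexDualNorm C(OnePoint X, ℝ) := by
  let Ω : Type := (Cardinal.aleph.{0} 1).ord.ToType
  have hcard : #Ω = Cardinal.aleph 1 := Cardinal.mk_ord_toType _
  have hunc : Uncountable Ω := by
    rw [← Cardinal.aleph0_lt_mk_iff, hcard]
    exact Cardinal.aleph0_lt_aleph_one
  have hΩ : ∀ α : Ω, (Set.Iic α).Countable := by
    intro α
    rw [← Set.Iio_insert]
    refine Set.Countable.insert _ ?_
    rw [← Cardinal.le_aleph0_iff_set_countable, ← Cardinal.lt_aleph_one_iff]
    have := Cardinal.mk_Iio_lt α (by rw [hcard]; exact (Ordinal.type_toType _).symm)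
    rwa [hcard] at this
  obtain ⟨e, he⟩ : ∃ e : Ω → ℕ → Bool, Function.Injective e := by
    have : #Ω ≤ #(ℕ → Bool) := by
      rw [hcard, CH]
      simp
    exact ⟨_, (Cardinal.le_def _ _ |>.1 this).some.injective⟩
  obtain ⟨ℓ, hℓ⟩ : ∃ ℓ : Ω → ℕ → Ω × Bool, Function.Surjective ℓ := by
    have : #(ℕ → Ω × Bool) = #Ω := by
      have h2 : #(Ω × Bool) = Cardinal.continuum := by
        rw [Cardinal.mk_prod, hcard, CH]
        simp
      -- CH makes `ℵ₁` equal to the continuum, which is unchanged by countable powers, so `Ω` can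
      -- index all sequences of points.
      rw [← Cardinal.power_def, h2, Cardinal.mk_nat, Cardinal.continuum_power_aleph0, hcard, CH]
    obtain ⟨f⟩ := Cardinal.eq.1 this
    exact ⟨f.symm, f.symm.surjective⟩
  obtain ⟨L, hL⟩ := TwinLadder.exists_isSaturated hΩ e he ℓ
  have hX := hL.not_isGruenhage hΩ hℓ
  exact ⟨L.Space, inferInstance,
    ⟨inferInstance, inferInstance, TwinLadder.isScatteredSpace, inferInstance,
      TwinLadder.isGδ_diagonal, hX⟩,
    ⟨inferInstance, inferInstance, TwinLadder.isScatteredSpace.onePoint,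
      fun h => hX (h.of_isOpenEmbedding OnePoint.isOpenEmbedding_coe),
      TwinLadder.hasStar_onePoint⟩,
    TwinLadder.dualAdmitsStrictlyConvexDualNorm⟩
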